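/- Let $N\ge 1$. The times are $\boldsymbol t=(t_{\alpha j})_{1\le\alpha\le N,\,j\ge1}$ and the charges are the vectors $\boldsymbol s\in\mathbb Z^N$ with $s_1+\dots+s_N=0$; $\boldsymbol e_\alpha$ denotes the $\alpha$-th unit vector, $E_\alpha$ the $N\times N$ matrix unit at the place $(\alpha,\alpha)$, $\xi(\boldsymbol t_\gamma,z)=\sum_{j\ge1}t_{\gamma j}z^j$, and $\boldsymbol t\pm[z^{-1}]_\gamma$ is obtained from $\boldsymbol t$ by replacing $t_{\gamma j}$ by $t_{\gamma j}\pm z^{-j}/j$ for all $j$. Let $\epsilon_{\alpha\gamma}(\boldsymbol s)=(-1)^{s_{\alpha+1}+\dots+s_\gamma}$ if $\alpha<\gamma$, $\epsilon_{\alpha\alpha}(\boldsymbol s)=1$, and $\epsilon_{\alpha\gamma}(\boldsymbol s)=-(-1)^{s_{\gamma+1}+\dots+s_\alpha}$ if $\alpha>\gamma$. Let $\tau(\boldsymbol s,\boldsymbol t)\in\mathbb C[[\boldsymbol t]]$ be a tau function of the $N$-component KP hierarchy: for all charges $\boldsymbol s,\boldsymbol s'$ and all $1\le\alpha,\beta\le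 N$, $$\sum_{\gamma=1}^N\epsilon_{\alpha\gamma}(\boldsymbol s)\epsilon_{\beta\gamma}(\boldsymbol s')\oint dz\, z^{s_\gamma-s'_\gamma+\delta_{\alpha\gamma}+\delta_{\beta\gamma}-2}e^{\xi(\boldsymbol t_\gamma-\boldsymbol t'_\gamma,z)}\,\tau(\boldsymbol s+\boldsymbol e_\alpha-\boldsymbol e_\gamma,\boldsymbol t-[z^{-1}]_\gamma)\,\tau(\boldsymbol s'-\boldsymbol e_\beta+\boldsymbol e_\gamma,\boldsymbol t'+[z^{-1}]_\gamma)=0$$ in $\mathbb C[[\boldsymbol t,\boldsymbol t']]$, where $\oint dz$ takes the coefficient of $z^{-1}$. Let $\mathcal K$ be the field of fractions of $\mathbb C[[\boldsymbol t]]$ and $\partial=\sum_{\kappa}\partial/\partial t_{\kappa1}$. Wherever $\tau(\boldsymbol s)\ne0$, expand the wave function $$\Psi_{\alpha\beta}(\boldsymbol s,\boldsymbol t,z)=\epsilon_{\alpha\beta}(\boldsymbol s)\frac{\tau(\boldsymbol s+\boldsymbol e_\alpha-\boldsymbol e_\beta,\boldsymbol t-[z^{-1}]_\beta)}{\tau(\boldsymbol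 s,\boldsymbol t)}z^{s_\beta+\delta_{\alpha\beta}-1}e^{\xi(\boldsymbol t_\beta,z)}=\Bigl(\sum_{j\ge0}(w_j)_{\alpha\beta}z^{-j}\Bigr)z^{s_\beta}e^{\xi(\boldsymbol t_\beta,z)}$$ (so $w_0$ is the identity matrix), and put, in the ring of formal pseudodifferential operators $\sum_{n\le m}a_n\partial^n$ with $N\times N$ matrix coefficients over $\mathcal K$, $$W(\boldsymbol s)=\Bigl(\sum_{j\ge0}w_j\partial^{-j}\Bigr)\mathrm{diag}(\partial^{s_1},\dots,\partial^{s_N}),\quad L=W\partial W^{-1},\quad R_\alpha=WE_\alpha W^{-1},\quad B_{\gamma j}=(L^jR_\gamma)_+,$$ where $(\cdot)_+$ keeps the powers $\partial^n$ with $n\ge0$. For $\alpha\ne\beta$ put $$P_{\alpha,\beta}(\boldsymbol s)=E_\alpha\partial+H(\boldsymbol s+\boldsymbol e_\alpha-\boldsymbol e_\beta)E_\alpha-E_\alpha H(\boldsymbol s)+\sum_{\gamma\ne\alpha,\beta}E_\gamma,$$ where $H_{\kappa\kappa}(\boldsymbol s)=-\partial_{t_{\kappa1}}\log\tau(\boldsymbol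 s,\boldsymbol t)$ and $H_{\lambda\kappa}(\boldsymbol s)=\epsilon_{\lambda\kappa}(\boldsymbol s)\,\tau(\boldsymbol s+\boldsymbol e_\lambda-\boldsymbol e_\kappa,\boldsymbol t)/\tau(\boldsymbol s,\boldsymbol t)$ for $\lambda\neq\kappa$. Derivatives of operators with respect to the times are taken coefficientwise. Then for every charge $\boldsymbol s$ with $\tau(\boldsymbol s)\ne0$: 1. $W(\boldsymbol s)$ is invertible, $L=\partial+\sum_{n\ge1}u_n\partial^{-n}$ and $R_\alpha=E_\alpha+\sum_{n\ge1}u_{\alpha n}\partial^{-n}$; 2. $LR_\alpha=R_\alpha L$, $R_\alpha R_\beta=\delta_{\alpha\beta}R_\alpha$ and $\sum_{\alpha}R_\alpha=1$; 3. $\dfrac{\partial L}{\partial t_{\gamma j}}=[B_{\gamma j},L]$ and $\dfrac{\partial R_\beta}{\partial t_{\gamma j}}=[B_{\gamma j},R_\beta]$ for all $\beta,\gamma$ and all $j\ge1$; 4. for all $\alpha\neq\beta$ with $\tau(\boldsymbol s+\boldsymbol e_\alpha-\boldsymbol e_\beta)\ne0$, all $\gamma$ and all $j\ge1$, $$W(\boldsymbol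 s+\boldsymbol e_\alpha-\boldsymbol e_\beta)=P_{\alpha,\beta}(\boldsymbol s)W(\boldsymbol s),$$ $$L(\boldsymbol s+\boldsymbol e_\alpha-\boldsymbol e_\beta)P_{\alpha,\beta}(\boldsymbol s)=P_{\alpha,\beta}(\boldsymbol s)L(\boldsymbol s),\qquad R_\gamma(\boldsymbol s+\boldsymbol e_\alpha-\boldsymbol e_\beta)P_{\alpha,\beta}(\boldsymbol s)=P_{\alpha,\beta}(\boldsymbol s)R_\gamma(\boldsymbol s),$$ $$\frac{\partial P_{\alpha,\beta}(\boldsymbol s)}{\partial t_{\gamma j}}=B_{\gamma j}(\boldsymbol s+\boldsymbol e_\alpha-\boldsymbol e_\beta)P_{\alpha,\beta}(\boldsymbol s)-P_{\alpha,\beta}(\boldsymbol s)B_{\gamma j}(\boldsymbol s).$$ -/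

import Mathlib

namespace MultiKP

open Finset

/-- A derivation of a (not necessarily commutative) ring. -/
structure AddDer (A : Type*) [Ring A] where
  toHom : A →+ A
  leibniz' : ∀ x y : A, toHom (x * y) = x * toHom y + toHom x * y

namespace AddDer
variable {A : Type*} [Ring A]

instance : CoeFun (AddDer A) (fun _ => A → A) := ⟨fun D => D.toHom⟩

theorem iter_zero (D : AddDer A) (k : ℕ) : D^[k] 0 = 0 :=
  Function.iterate_fixed (map_zero D.toHom) k

theorem iter_add (D : AddDer A) (k : ℕ) (x y : A) : D^[k] (x + y) = D^[k] x + D^[k] y := by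
  induction k generalizing x y with
  | zero => rfl
  | succ k ih => simp only [Function.iterate_succ, Function.comp, map_add, ih]

/-- the `k`-th iterate as an additive map -/
def iter (D : AddDer A) (k : ℕ) : A →+ A := ⟨⟨D^[k], D.iter_zero k⟩, D.iter_add k⟩

theorem iter_apply (D : AddDer A) (k : ℕ) (x : A) : D.iter k x = D^[k] x := rfl

theorem map_one (D : AddDer A) : D 1 = 0 := by
  have := D.leibniz' 1 1
  simpa using this

theorem iter_succ_one (D : AddDer A) (k : ℕ) : D^[k + 1] 1 = 0 := by
  simp only [Function.iterate_succ, Function.comp, map_one, iter_zero]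

theorem iter_mul (D : AddDer A) (k : ℕ) (x y : A) :
    D^[k] (x * y) = ∑ p ∈ antidiagonal k, k.choose p.1 • (D^[p.1] x * D^[p.2] y) := by
  induction k with
  | zero => simp
  | succ k ih =>
    rw [Function.iterate_succ_apply', ih, Finset.sum_antidiagonal_choose_succ_nsmul
      (fun i j => D^[i] x * D^[j] y), map_sum, ← sum_add_distrib]
    refine sum_congr rfl fun p hp => ?_
    rw [map_nsmul, D.leibniz', Function.iterate_succ_apply', Function.iterate_succ_apply',
      nsmul_add]
    rw [← Nat.choose_symm_of_eq_add (HasAntidiagonal.mem_antidiagonal.1 hp).symm]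

end AddDer

/-- Formal pseudodifferential operators `∑_{n ≤ m} a_n ∂ⁿ` with coefficients (on the left) in a ring
`A` with the derivation `D`. -/
@[ext]
structure PDO {A : Type*} [Ring A] (D : AddDer A) where
  coeff : ℤ → A
  bdd' : ∃ m : ℤ, ∀ n, m < n → coeff n = 0

namespace PDO
variable {A : Type*} [Ring A] {D : AddDer A}

/-- The coefficient of `∂ⁿ` in the product, from `∂^i b = ∑_{k ≥ 0} (i choose k) D^k(b) ∂^{i-k}`, where
`(i choose k) = i (i - 1) ⋯ (i - k + 1) / k!` for all integers `i`. -/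
noncomputable def mulCoeff (a b : PDO D) (n : ℤ) : A :=
  ∑ᶠ p : ℤ × ℕ, Ring.choose p.1 p.2 • (a.coeff p.1 * D^[p.2] (b.coeff (n - p.1 + p.2)))

theorem mulCoeff_eq (a b : PDO D) {M M' : ℤ} (ha : ∀ n, M < n → a.coeff n = 0)
    (hb : ∀ n, M' < n → b.coeff n = 0) {n : ℤ} {r : ℕ} (hn : n = M + M' - r) (S : ℕ) (hS : r < S) :
    mulCoeff a b n = ∑ u ∈ range S, ∑ v ∈ range S, ∑ k ∈ range S, if u + v + k = r then
      Ring.choose (M - u) k • (a.coeff (M - u) * D^[k] (b.coeff (M' - v))) else 0 := by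
  subst hn
  have h1 : ∀ u ∈ range S, ∀ k ∈ range S, (∑ v ∈ range S, if u + v + k = r then
      Ring.choose (M - u) k • (a.coeff (M - u) * D^[k] (b.coeff (M' - v))) else 0) =
      Ring.choose (M - u) k • (a.coeff (M - u) *
        D^[k] (b.coeff (M + M' - r - (M - u) + k))) := by
    intro u hu k hk
    by_cases h : u + k ≤ r
    · rw [sum_eq_single (r - u - k)]
      · rw [if_pos (by omega)]
        congr 4
        omega
      · intro v hv hne
        rw [if_neg (by omega)]
      · intro hv
        exact absurd (mem_range.2 (by omega)) hv
    · rw [hb (M + M' - r - (M - u) + k) (by omega), D.iter_zero, mul_zero, smul_zero]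
      exact sum_eq_zero fun v hv => if_neg (by omega)
  calc mulCoeff a b (M + M' - r)
      = ∑ p ∈ (range S ×ˢ range S).image (fun q : ℕ × ℕ => ((M - q.1 : ℤ), q.2)),
        Ring.choose p.1 p.2 • (a.coeff p.1 * D^[p.2] (b.coeff ((M + M' - r) - p.1 + p.2))) := by
        refine finsum_eq_sum_of_support_subset _ ?_
        rintro ⟨i, k⟩ hp
        have h1 : i ≤ M := by
          by_contra h
          exact hp (by simp [ha i (by omega)])
        have h2 : (M + M' - r) - i + k ≤ M' := by
          by_contra h
          exact hp (by simp [hb _ (not_le.1 h), D.iter_zero])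
        simp only [coe_image, Set.mem_image, mem_coe, mem_product, mem_range, Prod.mk.injEq,
          Prod.exists]
        exact ⟨(M - i).toNat, k, ⟨by omega, by omega⟩, by omega, rfl⟩
    _ = ∑ q ∈ range S ×ˢ range S, Ring.choose (M - q.1 : ℤ) q.2 • (a.coeff (M - q.1) *
          D^[q.2] (b.coeff (M + M' - r - (M - q.1) + q.2))) := by
        rw [sum_image]
        rintro ⟨x, y⟩ _ ⟨x', y'⟩ _ h
        simp only [Prod.mk.injEq] at h ⊢
        omega
    _ = _ := by
        rw [sum_product]
        refine sum_congr rfl fun u hu => ?_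
        rw [sum_comm]
        exact sum_congr rfl fun k hk => (h1 u hu k hk).symm

theorem mulCoeff_eq_zero (a b : PDO D) {M M' : ℤ} (ha : ∀ n, M < n → a.coeff n = 0)
    (hb : ∀ n, M' < n → b.coeff n = 0) (n : ℤ) (hn : M + M' < n) : mulCoeff a b n = 0 := by
  refine finsum_eq_zero_of_forall_eq_zero fun p => ?_
  by_cases h : M < p.1
  · simp [ha _ h]
  · rw [hb _ (by omega), D.iter_zero, mul_zero, smul_zero]

/-- A common upper bound for the order. -/
theorem exists_bdd (a : PDO D) : ∃ m : ℤ, ∀ m', m ≤ m' → ∀ n, m' < n → a.coeff n = 0 := by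
  obtain ⟨m, hm⟩ := a.bdd'
  exact ⟨m, fun m' h n hn => hm n (h.trans_lt hn)⟩

instance : Zero (PDO D) := ⟨⟨fun _ => 0, 0, fun _ _ => rfl⟩⟩

instance : Add (PDO D) := ⟨fun a b => ⟨fun n => a.coeff n + b.coeff n, by
  obtain ⟨m, hm⟩ := a.exists_bdd
  obtain ⟨m', hm'⟩ := b.exists_bdd
  exact ⟨max m m', fun n hn => by
    rw [hm _ (le_max_left _ _) n hn, hm' _ (le_max_right _ _) n hn, add_zero]⟩⟩⟩

instance : Neg (PDO D) := ⟨fun a => ⟨fun n => -a.coeff n, by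
  obtain ⟨m, hm⟩ := a.bdd'
  exact ⟨m, fun n hn => by rw [hm n hn, neg_zero]⟩⟩⟩

/-- The operator `a ∂ⁿ`. -/
def single (n : ℤ) (a : A) : PDO D :=
  ⟨fun m => if m = n then a else 0, n, fun _ hm => if_neg hm.ne'⟩

instance : One (PDO D) := ⟨single 0 1⟩

noncomputable instance : Mul (PDO D) := ⟨fun a b => ⟨mulCoeff a b, by
  obtain ⟨m, hm⟩ := a.bdd'
  obtain ⟨m', hm'⟩ := b.bdd'
  exact ⟨m + m', mulCoeff_eq_zero a b hm hm'⟩⟩⟩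

theorem coeff_zero (n : ℤ) : (0 : PDO D).coeff n = 0 := rfl
theorem coeff_add (a b : PDO D) (n : ℤ) : (a + b).coeff n = a.coeff n + b.coeff n := rfl
theorem coeff_neg (a : PDO D) (n : ℤ) : (-a).coeff n = -a.coeff n := rfl
theorem coeff_mul (a b : PDO D) (n : ℤ) : (a * b).coeff n = mulCoeff a b n := rfl
theorem coeff_single (n m : ℤ) (a : A) :
    (single n a : PDO D).coeff m = if m = n then a else 0 := rfl
theorem coeff_one (m : ℤ) : (1 : PDO D).coeff m = if m = 0 then 1 else 0 := rfl

instance : AddCommGroup (PDO D) where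
  add_assoc a b c := by ext n; simp only [coeff_add, add_assoc]
  zero_add a := by ext n; simp only [coeff_add, coeff_zero, zero_add]
  add_zero a := by ext n; simp only [coeff_add, coeff_zero, add_zero]
  add_comm a b := by ext n; simp only [coeff_add, add_comm]
  neg_add_cancel a := by ext n; simp only [coeff_add, coeff_neg, coeff_zero, neg_add_cancel]
  nsmul := nsmulRec
  zsmul := zsmulRec

protected theorem one_mul (a : PDO D) : 1 * a = a := by
  ext n
  rw [coeff_mul, mulCoeff, finsum_eq_single _ ((0 : ℤ), 0)]
  · simp [coeff_one]
  · rintro ⟨i, k⟩ h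
    by_cases hi : i = 0
    · subst hi
      have hk : 0 < k := Nat.pos_of_ne_zero fun hk => h (by rw [hk])
      rw [Ring.choose_zero_pos ℤ hk, zero_smul]
    · simp [coeff_one, hi]

protected theorem mul_one (a : PDO D) : a * 1 = a := by
  ext n
  rw [coeff_mul, mulCoeff, finsum_eq_single _ (n, 0)]
  · simp [coeff_one]
  · rintro ⟨i, k⟩ h
    rcases k with _ | k
    · have hi : n - i ≠ 0 := fun hi => h (by rw [sub_eq_zero.1 hi])
      simp [coeff_one, hi]
    · simp only [coeff_one]
      split_ifs
      · rw [D.iter_succ_one, mul_zero, smul_zero]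
      · rw [D.iter_zero, mul_zero, smul_zero]

/-- bounds for three operators, and the natural number parametrising a coefficient -/
theorem exists_bdd₃ (a b c : PDO D) : ∃ M : ℤ, (∀ n, M < n → a.coeff n = 0) ∧
    (∀ n, M < n → b.coeff n = 0) ∧ (∀ n, M < n → c.coeff n = 0) := by
  obtain ⟨m, hm⟩ := a.exists_bdd
  obtain ⟨m', hm'⟩ := b.exists_bdd
  obtain ⟨m'', hm''⟩ := c.exists_bdd
  exact ⟨max m (max m' m''), hm _ (by simp), hm' _ (by simp), hm'' _ (by simp)⟩

protected theorem mul_add (a b c : PDO D) : a * (b + c) = a * b + a * c := by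
  obtain ⟨M, ha, hb, hc⟩ := exists_bdd₃ a b c
  have hbc : ∀ n, M < n → (b + c).coeff n = 0 := fun n hn => by
    rw [coeff_add, hb n hn, hc n hn, add_zero]
  ext n
  rw [coeff_add, coeff_mul, coeff_mul, coeff_mul]
  rcases lt_or_ge (M + M) n with h | h
  · rw [mulCoeff_eq_zero _ _ ha hbc n h, mulCoeff_eq_zero _ _ ha hb n h,
      mulCoeff_eq_zero _ _ ha hc n h, add_zero]
  · obtain ⟨r, hr⟩ := Int.eq_ofNat_of_zero_le (sub_nonneg.2 h)
    have hr : n = M + M - r := by omega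
    rw [mulCoeff_eq _ _ ha hbc hr (r + 1) (by omega), mulCoeff_eq _ _ ha hb hr (r + 1) (by omega),
      mulCoeff_eq _ _ ha hc hr (r + 1) (by omega)]
    simp only [← sum_add_distrib]
    refine sum_congr rfl fun u _ => sum_congr rfl fun v _ => sum_congr rfl fun k _ => ?_
    split_ifs
    · rw [coeff_add, D.iter_add, mul_add, smul_add]
    · rw [add_zero]

protected theorem add_mul (a b c : PDO D) : (a + b) * c = a * c + b * c := by
  obtain ⟨M, ha, hb, hc⟩ := exists_bdd₃ a b c
  have hab : ∀ n, M < n → (a + b).coeff n = 0 := fun n hn => by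
    rw [coeff_add, ha n hn, hb n hn, add_zero]
  ext n
  rw [coeff_add, coeff_mul, coeff_mul, coeff_mul]
  rcases lt_or_ge (M + M) n with h | h
  · rw [mulCoeff_eq_zero _ _ hab hc n h, mulCoeff_eq_zero _ _ ha hc n h,
      mulCoeff_eq_zero _ _ hb hc n h, add_zero]
  · obtain ⟨r, hr⟩ := Int.eq_ofNat_of_zero_le (sub_nonneg.2 h)
    have hr : n = M + M - r := by omega
    rw [mulCoeff_eq _ _ hab hc hr (r + 1) (by omega), mulCoeff_eq _ _ ha hc hr (r + 1) (by omega),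
      mulCoeff_eq _ _ hb hc hr (r + 1) (by omega)]
    simp only [← sum_add_distrib]
    refine sum_congr rfl fun u _ => sum_congr rfl fun v _ => sum_congr rfl fun k _ => ?_
    split_ifs
    · rw [coeff_add, add_mul, smul_add]
    · rw [add_zero]

/-- The binomial identity behind associativity. -/
theorem choose_identity (x y : ℤ) (k l : ℕ) :
    Ring.choose x k * Ring.choose (x + y - k) l =
      ∑ p ∈ antidiagonal l, Ring.choose x (k + p.1) * Ring.choose y p.2 * ((k + p.1).choose k : ℤ) := by
  have h : x + y - k = (x - k) + y := by ring
  rw [h, Ring.add_choose_eq l (Commute.all _ _), mul_sum]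
  refine sum_congr rfl fun p _ => ?_
  have h2 := Ring.choose_smul_choose x (Nat.le_add_right k p.1)
  rw [Nat.add_sub_cancel_left, nsmul_eq_mul] at h2
  linear_combination (-Ring.choose y p.2) * h2

theorem sum_range_antidiagonal {B : Type*} [AddCommMonoid B] (S R : ℕ) (h : R < S)
    (f : ℕ → ℕ → B) :
    (∑ k ∈ range S, ∑ l ∈ range S, if k + l = R then f k l else 0) =
      ∑ p ∈ antidiagonal R, f p.1 p.2 := by
  rw [← sum_product', ← sum_filter]
  refine sum_congr ?_ fun _ _ => rfl
  ext ⟨k, l⟩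
  simp only [mem_filter, mem_product, mem_range, HasAntidiagonal.mem_antidiagonal]
  omega

theorem assoc_kernel (x y : ℤ) (a b c : A) (R : ℕ) :
    (∑ p ∈ antidiagonal R, (Ring.choose x p.1 * Ring.choose (x + y - p.1) p.2) •
      (a * D^[p.1] b * D^[p.2] c)) =
    ∑ p ∈ antidiagonal R, (Ring.choose x p.1 * Ring.choose y p.2) •
      (a * D^[p.1] (b * D^[p.2] c)) := by
  have h1 : ∀ p ∈ antidiagonal R, (Ring.choose x p.1 * Ring.choose y p.2) •
      (a * D^[p.1] (b * D^[p.2] c)) = ∑ q ∈ antidiagonal p.1,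
        (Ring.choose x (q.1 + q.2) * Ring.choose y p.2 * ((q.1 + q.2).choose q.1 : ℤ)) •
          (a * D^[q.1] b * D^[q.2 + p.2] c) := by
    intro p _
    rw [D.iter_mul, mul_sum, smul_sum]
    refine sum_congr rfl fun q hq => ?_
    rw [HasAntidiagonal.mem_antidiagonal.1 hq, ← Function.iterate_add_apply, mul_smul_comm, ← mul_assoc,
      ← natCast_zsmul, smul_smul]
  have h2 : ∀ p ∈ antidiagonal R, (Ring.choose x p.1 * Ring.choose (x + y - p.1) p.2) •
      (a * D^[p.1] b * D^[p.2] c) = ∑ q ∈ antidiagonal p.2,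
        (Ring.choose x (p.1 + q.1) * Ring.choose y q.2 * ((p.1 + q.1).choose p.1 : ℤ)) •
          (a * D^[p.1] b * D^[q.1 + q.2] c) := by
    intro p _
    rw [choose_identity, sum_smul]
    refine sum_congr rfl fun q hq => ?_
    rw [HasAntidiagonal.mem_antidiagonal.1 hq]
  rw [sum_congr rfl h1, sum_congr rfl h2]
  simp only [sum_sigma']
  refine sum_nbij' (fun x => ⟨(x.1.1 + x.2.1, x.2.2), (x.1.1, x.2.1)⟩)
    (fun x => ⟨(x.2.1, x.2.2 + x.1.2), (x.2.2, x.1.2)⟩) ?_ ?_ ?_ ?_ ?_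
  · rintro ⟨⟨k, l⟩, ⟨q, s⟩⟩ h
    simp only [mem_sigma, HasAntidiagonal.mem_antidiagonal] at h ⊢
    exact ⟨by omega, trivial⟩
  · rintro ⟨⟨k, l⟩, ⟨q, s⟩⟩ h
    simp only [mem_sigma, HasAntidiagonal.mem_antidiagonal] at h ⊢
    exact ⟨by omega, trivial⟩
  · rintro ⟨⟨k, l⟩, ⟨q, s⟩⟩ h
    simp only [mem_sigma, HasAntidiagonal.mem_antidiagonal] at h
    obtain ⟨_, rfl⟩ := h
    rfl
  · rintro ⟨⟨k, l⟩, ⟨q, s⟩⟩ h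
    simp only [mem_sigma, HasAntidiagonal.mem_antidiagonal] at h
    obtain ⟨_, rfl⟩ := h
    rfl
  · rintro ⟨⟨k, l⟩, ⟨q, s⟩⟩ h
    rfl

theorem assoc_kernel' (x y : ℤ) (a b c : A) (R S : ℕ) (h : R < S) (t : ℕ) :
    (∑ k ∈ range S, ∑ l ∈ range S, if t + k + l = R then
      (Ring.choose x k * Ring.choose (x + y - k) l) • (a * D^[k] b * D^[l] c) else 0) =
    ∑ k ∈ range S, ∑ l ∈ range S, if t + k + l = R then
      (Ring.choose x k * Ring.choose y l) • (a * D^[k] (b * D^[l] c)) else 0 := by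
  by_cases ht : t ≤ R
  · have hiff : ∀ k l : ℕ, t + k + l = R ↔ k + l = R - t := fun k l => by omega
    simp only [hiff]
    rw [sum_range_antidiagonal S (R - t) (by omega) (fun k l =>
        (Ring.choose x k * Ring.choose (x + y - k) l) • (a * D^[k] b * D^[l] c)),
      sum_range_antidiagonal S (R - t) (by omega) (fun k l =>
        (Ring.choose x k * Ring.choose y l) • (a * D^[k] (b * D^[l] c)))]
    exact assoc_kernel x y a b c (R - t)
  · have hiff : ∀ k l : ℕ, ¬ t + k + l = R := fun k l => by omega
    simp only [hiff, if_false]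

theorem reorder {B : Type*} [AddCommMonoid B] (S : ℕ) (f : ℕ → ℕ → ℕ → ℕ → ℕ → B) :
    (∑ w ∈ range S, ∑ l ∈ range S, ∑ u ∈ range S, ∑ v ∈ range S, ∑ k ∈ range S, f u v w k l) =
      ∑ u ∈ range S, ∑ v ∈ range S, ∑ w ∈ range S, ∑ k ∈ range S, ∑ l ∈ range S, f u v w k l := by
  refine (sum_congr rfl fun w _ => sum_comm).trans ?_
  refine sum_comm.trans (sum_congr rfl fun u _ => ?_)
  refine (sum_congr rfl fun w _ => sum_comm).trans ?_
  exact sum_comm.trans (sum_congr rfl fun v _ => sum_congr rfl fun w _ => sum_comm)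

protected theorem mul_assoc (a b c : PDO D) : a * b * c = a * (b * c) := by
  obtain ⟨M, ha, hb, hc⟩ := exists_bdd₃ a b c
  have hab : ∀ n, M + M < n → (a * b).coeff n = 0 := mulCoeff_eq_zero a b ha hb
  have hbc : ∀ n, M + M < n → (b * c).coeff n = 0 := mulCoeff_eq_zero b c hb hc
  ext n
  rw [coeff_mul, coeff_mul]
  rcases lt_or_ge (M + M + M) n with h | h
  · rw [mulCoeff_eq_zero _ _ hab hc n h, mulCoeff_eq_zero _ _ ha hbc n (by omega)]
  obtain ⟨r, hr⟩ := Int.eq_ofNat_of_zero_le (sub_nonneg.2 h)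
  rw [mulCoeff_eq _ _ hab hc (r := r) (by omega) (r + 1) (by omega),
    mulCoeff_eq _ _ ha hbc (r := r) (by omega) (r + 1) (by omega)]
  set S := r + 1 with hS
  have hl : ∀ e ∈ range S, ∀ w ∈ range S, ∀ l ∈ range S, (if e + w + l = r then
      Ring.choose (M + M - e) l • ((a * b).coeff (M + M - e) * D^[l] (c.coeff (M - w))) else 0) =
      ∑ u ∈ range S, ∑ v ∈ range S, ∑ k ∈ range S, if u + v + k = e then
        (if u + v + w + k + l = r then (Ring.choose (M - u) k * Ring.choose (M - u + (M - v) - k) l) •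
          (a.coeff (M - u) * D^[k] (b.coeff (M - v)) * D^[l] (c.coeff (M - w))) else 0) else 0 := by
    intro e he w hw l hl
    rw [coeff_mul, mulCoeff_eq a b ha hb (r := e) rfl S (mem_range.1 he)]
    split_ifs with h1
    · simp only [sum_mul, smul_sum]
      refine sum_congr rfl fun u _ => sum_congr rfl fun v _ => sum_congr rfl fun k _ => ?_
      split_ifs with h2 h3
      · rw [smul_mul_assoc, smul_smul, mul_comm]
        congr 3
        omega
      · omega
      · rw [zero_mul, smul_zero]
    · symm
      refine sum_eq_zero fun u _ => sum_eq_zero fun v _ => sum_eq_zero fun k _ => ?_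
      split_ifs <;> first | rfl | omega
  have hrr : ∀ u ∈ range S, ∀ f ∈ range S, ∀ k ∈ range S, (if u + f + k = r then
      Ring.choose (M - u) k • (a.coeff (M - u) * D^[k] ((b * c).coeff (M + M - f))) else 0) =
      ∑ v ∈ range S, ∑ w ∈ range S, ∑ l ∈ range S, if v + w + l = f then
        (if u + v + w + k + l = r then (Ring.choose (M - u) k * Ring.choose (M - v) l) •
          (a.coeff (M - u) * D^[k] (b.coeff (M - v) * D^[l] (c.coeff (M - w)))) else 0) else 0 := by
    intro u hu f hf k hk
    rw [coeff_mul, mulCoeff_eq b c hb hc (r := f) rfl S (mem_range.1 hf)]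
    split_ifs with h1
    · simp only [← D.iter_apply, map_sum, mul_sum, smul_sum]
      refine sum_congr rfl fun v _ => sum_congr rfl fun w _ => sum_congr rfl fun l _ => ?_
      split_ifs with h2 h3
      · rw [map_zsmul, mul_smul_comm, smul_smul]
      · omega
      · rw [map_zero, mul_zero, smul_zero]
    · symm
      refine sum_eq_zero fun v _ => sum_eq_zero fun w _ => sum_eq_zero fun l _ => ?_
      split_ifs <;> first | rfl | omega
  rw [sum_congr rfl fun e he => sum_congr rfl fun w hw => sum_congr rfl fun l hl' => hl e he w hw l hl',
    sum_congr rfl fun u hu => sum_congr rfl fun f hf => sum_congr rfl fun k hk => hrr u hu f hf k hk]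
  trans ∑ u ∈ range S, ∑ v ∈ range S, ∑ w ∈ range S, ∑ k ∈ range S, ∑ l ∈ range S,
    if u + v + w + k + l = r then (Ring.choose (M - u) k * Ring.choose (M - u + (M - v) - k) l) •
          (a.coeff (M - u) * D^[k] (b.coeff (M - v)) * D^[l] (c.coeff (M - w))) else 0
  · refine Eq.trans ?_ (reorder S _)
    refine sum_comm.trans (sum_congr rfl fun w _ => ?_)
    refine sum_comm.trans (sum_congr rfl fun l _ => ?_)
    refine sum_comm.trans (sum_congr rfl fun u _ => ?_)
    refine sum_comm.trans (sum_congr rfl fun v _ => ?_)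
    refine sum_comm.trans (sum_congr rfl fun k _ => ?_)
    rw [sum_ite_eq]
    split_ifs with h1 h2 <;> first | rfl | skip
    exact absurd (mem_range.2 (by omega)) h1
  · refine (sum_congr rfl fun (u : ℕ) _ => sum_congr rfl fun (v : ℕ) _ => sum_congr rfl fun (w : ℕ) _ =>
      assoc_kernel' (M - u) (M - v) _ _ _ r S (by omega) (u + v + w : ℕ)).trans ?_
    refine sum_congr rfl fun u _ => ?_
    symm
    refine Eq.trans ?_ (sum_congr rfl fun v _ => sum_comm)
    refine Eq.trans ?_ sum_comm
    refine sum_comm.trans (sum_congr rfl fun k _ => ?_)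
    refine sum_comm.trans (sum_congr rfl fun v _ => ?_)
    refine sum_comm.trans (sum_congr rfl fun w _ => ?_)
    refine sum_comm.trans (sum_congr rfl fun l _ => ?_)
    rw [sum_ite_eq]
    split_ifs with h1 h2 <;> first | rfl | skip
    exact absurd (mem_range.2 (by omega)) h1

noncomputable instance : Ring (PDO D) where
  mul_assoc := PDO.mul_assoc
  one_mul := PDO.one_mul
  mul_one := PDO.mul_one
  left_distrib := PDO.mul_add
  right_distrib := PDO.add_mul
  zero_mul a := by
    have h := PDO.add_mul 0 0 a
    rwa [add_zero, left_eq_add] at h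
  mul_zero a := by
    have h := PDO.mul_add a 0 0
    rwa [add_zero, left_eq_add] at h
  neg_add_cancel := neg_add_cancel
  zsmul := zsmulRec

end PDO

namespace PDO
variable {A : Type*} [Ring A] {D : AddDer A}

/-- The differential part `a_+`: the terms `a_n ∂ⁿ` with `n ≥ 0`. -/
noncomputable def diffPart (a : PDO D) : PDO D :=
  ⟨fun n => if 0 ≤ n then a.coeff n else 0, by
    obtain ⟨m, hm⟩ := a.bdd'
    exact ⟨m, fun n hn => by rw [hm n hn, ite_self]⟩⟩

/-- An additive map of the coefficient ring, applied to every coefficient. -/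
def mapCoeff (f : A →+ A) (a : PDO D) : PDO D :=
  ⟨fun n => f (a.coeff n), by
    obtain ⟨m, hm⟩ := a.bdd'
    exact ⟨m, fun n hn => by rw [hm n hn, map_zero]⟩⟩

end PDO

section FractionField

variable {A : Type*} [CommRing A] [Algebra ℂ A]

/-- The ring homomorphism `a ↦ a + ε d(a)` into the dual numbers over the fraction field. -/
noncomputable def dualLift (d : Derivation ℂ A A) :
    A →+* TrivSqZeroExt (FractionRing A) (FractionRing A) where
  toFun a := (algebraMap A _ a, algebraMap A _ (d a))
  map_one' := by
    refine TrivSqZeroExt.ext (map_one _) ?_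
    change algebraMap A (FractionRing A) (d 1) = 0
    rw [d.map_one_eq_zero, map_zero]
  map_zero' := by
    refine TrivSqZeroExt.ext (map_zero _) ?_
    change algebraMap A (FractionRing A) (d 0) = 0
    rw [map_zero, map_zero]
  map_add' a b := by
    refine TrivSqZeroExt.ext (map_add _ _ _) ?_
    change algebraMap A (FractionRing A) (d (a + b)) = algebraMap A _ (d a) + algebraMap A _ (d b)
    rw [map_add, map_add]
  map_mul' a b := by
    refine TrivSqZeroExt.ext (map_mul _ _ _) ?_
    change algebraMap A (FractionRing A) (d (a * b)) =
      algebraMap A (FractionRing A) a • algebraMap A (FractionRing A) (d b) +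
        MulOpposite.op (algebraMap A (FractionRing A) b) • algebraMap A (FractionRing A) (d a)
    rw [smul_eq_mul, MulOpposite.smul_eq_mul_unop, MulOpposite.unop_op]
    rw [d.leibniz, map_add, smul_eq_mul, smul_eq_mul, map_mul, map_mul,
      mul_comm (algebraMap A (FractionRing A) b)]

theorem dualLift_isUnit (d : Derivation ℂ A A) (a : nonZeroDivisors A) : IsUnit (dualLift d a) := by
  rw [TrivSqZeroExt.isUnit_iff_isUnit_fst]
  exact IsLocalization.map_units (FractionRing A) a

/-- The extension of `dualLift d` to the fraction field. -/
noncomputable def dualLiftFrac (d : Derivation ℂ A A) :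
    FractionRing A →+* TrivSqZeroExt (FractionRing A) (FractionRing A) :=
  IsLocalization.lift (M := nonZeroDivisors A) (dualLift_isUnit d)

theorem dualLiftFrac_algebraMap (d : Derivation ℂ A A) (a : A) :
    dualLiftFrac d (algebraMap A _ a) = dualLift d a :=
  IsLocalization.lift_eq _ a

theorem dualLiftFrac_fst (d : Derivation ℂ A A) (x : FractionRing A) :
    (dualLiftFrac d x).fst = x := by
  have h : ((TrivSqZeroExt.fstHom (FractionRing A) (FractionRing A) (FractionRing A)).toRingHom.comp
      (dualLiftFrac d)) = RingHom.id _ := by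
    refine IsLocalization.ringHom_ext (nonZeroDivisors A) (RingHom.ext fun a => ?_)
    change (dualLiftFrac d (algebraMap A _ a)).fst = algebraMap A _ a
    rw [dualLiftFrac_algebraMap]
    rfl
  exact RingHom.congr_fun h x

/-- The extension of a derivation to the ring of fractions (the fraction field, for a domain). -/
noncomputable def fracDer (d : Derivation ℂ A A) : AddDer (FractionRing A) where
  toHom :=
    { toFun := fun x => (dualLiftFrac d x).snd
      map_zero' := by rw [map_zero, TrivSqZeroExt.snd_zero]
      map_add' := fun x y => by rw [map_add, TrivSqZeroExt.snd_add] }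
  leibniz' x y := by
    change (dualLiftFrac d (x * y)).snd = x * (dualLiftFrac d y).snd + (dualLiftFrac d x).snd * y
    rw [map_mul, TrivSqZeroExt.snd_mul, dualLiftFrac_fst, dualLiftFrac_fst]
    rfl

/-- `fracDer d` does extend `d`. -/
theorem fracDer_algebraMap (d : Derivation ℂ A A) (a : A) :
    fracDer d (algebraMap A _ a) = algebraMap A (FractionRing A) (d a) := by
  change (dualLiftFrac d (algebraMap A _ a)).snd = _
  rw [dualLiftFrac_algebraMap]
  rfl

end FractionField

/-- A derivation of a ring, acting entrywise on square matrices. -/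
def AddDer.matrix {A : Type*} [Ring A] (D : AddDer A) (N : ℕ) :
    AddDer (Matrix (Fin N) (Fin N) A) where
  toHom := D.toHom.mapMatrix
  leibniz' X Y := by
    ext i j
    simp only [AddMonoidHom.mapMatrix_apply, Matrix.map_apply, Matrix.add_apply, Matrix.mul_apply,
      map_sum, D.leibniz', sum_add_distrib]

/-! ### Times, charges and tau functions -/

/-- `(α, j)` is the index of the time variable `t_{α j}`, `j ≥ 1`. -/
abbrev TimeIdx (N : ℕ) : Type := Fin N × ℕ+

/-- Formal power series in all the time variables. -/
abbrev Ser (N : ℕ) : Type := MvPowerSeries (TimeIdx N) ℂ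

/-- The field of fractions of `Ser N`. -/
abbrev Fld (N : ℕ) : Type := FractionRing (Ser N)

instance (N : ℕ) : IsDomain (Ser N) := NoZeroDivisors.to_isDomain _

/-- The charge vectors `s ∈ ℤ^N` with `s_1 + ⋯ + s_N = 0`. -/
def Charge (N : ℕ) : AddSubgroup (Fin N → ℤ) where
  carrier := {s | ∑ i, s i = 0}
  zero_mem' := by simp
  add_mem' {a b} ha hb := by
    simp only [Set.mem_ofPred_eq] at ha hb
    simp [sum_add_distrib, ha, hb]
  neg_mem' {a} ha := by
    simp only [Set.mem_ofPred_eq] at ha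
    simp [ha]

/-- The charge vector `e_α - e_β`. -/
def root {N : ℕ} (α β : Fin N) : Charge N :=
  ⟨Pi.single α 1 - Pi.single β 1, by simp [Charge]⟩

/-- The sign `ε_{αγ}(s)`. -/
def eps {N : ℕ} (α γ : Fin N) (s : Charge N) : ℤ :=
  if α < γ then ((∑ i ∈ Ioc α γ, s.1 i).negOnePow : ℤ)
  else if α = γ then 1
  else -((∑ i ∈ Ioc γ α, s.1 i).negOnePow : ℤ)

/-- The family `t_{α j} + c δ_{αγ} z^{-j} / j`; the variable `none` stands for `z⁻¹`. -/
noncomputable def shiftFamily {N : ℕ} (c : ℂ) (γ : Fin N) (p : TimeIdx N) :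
    MvPowerSeries (Option (TimeIdx N)) ℂ :=
  MvPowerSeries.X (some p) +
    if p.1 = γ then MvPowerSeries.C (c / (p.2 : ℕ)) * MvPowerSeries.X none ^ (p.2 : ℕ) else 0

/-- The family may be substituted into every power series. -/
theorem hasSubst_shiftFamily {N : ℕ} (c : ℂ) (γ : Fin N) :
    MvPowerSeries.HasSubst (shiftFamily c γ) where
  const_coeff p := by
    have h : MvPowerSeries.constantCoeff (shiftFamily c γ p) = 0 := by
      unfold shiftFamily
      split_ifs <;> simp
    rw [h]
    exact IsNilpotent.zero
  coeff_zero d := by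
    have h1 : {p : TimeIdx N | d = Finsupp.single (some p) 1}.Subsingleton := by
      intro p hp q hq
      exact Option.some_injective _ (Finsupp.single_left_injective one_ne_zero (hp.symm.trans hq))
    have h2 : {p : TimeIdx N | p.1 = γ ∧ d = Finsupp.single none (p.2 : ℕ)}.Subsingleton := by
      rintro ⟨_, p⟩ ⟨rfl, hp⟩ ⟨_, q⟩ ⟨rfl, hq⟩
      have h := Finsupp.single_injective _ (hp.symm.trans hq)
      exact congrArg (Prod.mk _) (PNat.coe_inj.1 h)
    refine (h1.finite.union h2.finite).subset fun p hp => ?_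
    by_contra hc
    simp only [Set.mem_union, Set.mem_ofPred_eq, not_or, not_and] at hc
    refine hp ?_
    unfold shiftFamily
    rw [map_add, MvPowerSeries.coeff_X, if_neg hc.1, zero_add]
    split_ifs with h
    · rw [MvPowerSeries.coeff_C_mul, MvPowerSeries.coeff_X_pow, if_neg (hc.2 h), mul_zero]
    · rw [map_zero]

/-- `f(t + c [z⁻¹]_γ)` as a power series in `z⁻¹`. -/
noncomputable def shift {N : ℕ} (c : ℂ) (γ : Fin N) (f : Ser N) : PowerSeries (Ser N) :=
  MvPowerSeries.optionEquivLeft (TimeIdx N) ℂ (MvPowerSeries.subst (shiftFamily c γ) f)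

/-- Formal power series in two independent copies `t` (`inl`) and `t'` (`inr`) of the times. -/
abbrev Ser₂ (N : ℕ) : Type := MvPowerSeries (TimeIdx N ⊕ TimeIdx N) ℂ

instance instTendstoCofiniteInl (N : ℕ) :
    Filter.TendstoCofinite (Sum.inl : TimeIdx N → TimeIdx N ⊕ TimeIdx N) :=
  ⟨Sum.inl_injective.tendsto_cofinite⟩

instance instTendstoCofiniteInr (N : ℕ) :
    Filter.TendstoCofinite (Sum.inr : TimeIdx N → TimeIdx N ⊕ TimeIdx N) :=
  ⟨Sum.inr_injective.tendsto_cofinite⟩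

/-- `ξ(t_γ - t'_γ, z)` as a power series in `z`. -/
noncomputable def xi {N : ℕ} (γ : Fin N) : PowerSeries (Ser₂ N) :=
  PowerSeries.mk fun j => if h : 0 < j then
    MvPowerSeries.X (Sum.inl (γ, ⟨j, h⟩)) - MvPowerSeries.X (Sum.inr (γ, ⟨j, h⟩)) else 0

/-- `exp ξ(t_γ - t'_γ, z)` as a power series in `z`. -/
noncomputable def expXi {N : ℕ} (γ : Fin N) : PowerSeries (Ser₂ N) :=
  (PowerSeries.exp ℂ).subst (xi γ)

/-- The residue `∮ dz z^n a(z) b(z⁻¹)`, i.e. the coefficient of `z⁻¹` in `z^n a(z) b(z⁻¹)`, computed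
for each monomial in the times separately: the sum of all `a_k b_m` with `n + k - m = -1`. -/
noncomputable def residue {σ : Type*} (n : ℤ) (a b : PowerSeries (MvPowerSeries σ ℂ)) :
    MvPowerSeries σ ℂ := fun d =>
  ∑ᶠ p : ℕ × ℕ, if n + p.1 - p.2 = -1 then
    MvPowerSeries.coeff d (PowerSeries.coeff p.1 a * PowerSeries.coeff p.2 b) else 0

/-- The Kronecker symbol as an integer. -/
def kd {N : ℕ} (α β : Fin N) : ℤ := if α = β then 1 else 0

/-- The bilinear identities that define the tau functions of the `N`-component KP hierarchy. -/
def IsTau {N : ℕ} (τ : Charge N → Ser N) : Prop :=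
  ∀ (s s' : Charge N) (α β : Fin N),
    ∑ γ, (eps α γ s * eps β γ s') •
      residue (s.1 γ - s'.1 γ + kd α γ + kd β γ - 2) (expXi γ)
        (PowerSeries.map (MvPowerSeries.rename Sum.inl).toRingHom
            (shift (-1) γ (τ (s + root α γ))) *
          PowerSeries.map (MvPowerSeries.rename Sum.inr).toRingHom
            (shift 1 γ (τ (s' - root β γ)))) = 0

/-! ### The operators of the hierarchy -/

/-- Matrices over the field `Fld N`. -/
abbrev Mat (N : ℕ) : Type := Matrix (Fin N) (Fin N) (Fld N)

/-- The derivation `∂/∂t_{γ j}` of `Fld N`. -/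
noncomputable def dt {N : ℕ} (p : TimeIdx N) : AddDer (Fld N) :=
  fracDer (MvPowerSeries.pderiv ℂ p)

/-- The derivation `∂ = ∑_κ ∂/∂t_{κ 1}` of `Fld N`. -/
noncomputable def del (N : ℕ) : AddDer (Fld N) :=
  fracDer (∑ κ : Fin N, MvPowerSeries.pderiv ℂ ((κ, 1) : TimeIdx N))

/-- Pseudodifferential operators in `∂` with matrix coefficients. -/
abbrev Op (N : ℕ) : Type := PDO ((del N).matrix N)

/-- `∂/∂t_{γ j}` of an operator, coefficient by coefficient. -/
noncomputable def opDt {N : ℕ} (γ : Fin N) (j : ℕ+) (a : Op N) : Op N :=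
  a.mapCoeff ((dt (γ, j)).matrix N).toHom

/-- The matrix unit `E_α` at the place `(α, α)`. -/
noncomputable def E {N : ℕ} (α : Fin N) : Mat N := Matrix.single α α 1

/-- The operator `∂`. -/
noncomputable def delOp (N : ℕ) : Op N := PDO.single 1 1

variable {N : ℕ}

/-- The coefficient `w_j(s, t)` in the expansion
`Ψ_{αβ} = (∑_{j ≥ 0} (w_j)_{αβ} z^{-j}) z^{s_β} exp ξ(t_β, z)` of the wave function
`Ψ_{αβ} = ε_{αβ}(s) τ(s + e_α - e_β, t - [z⁻¹]_β) / τ(s, t) z^{s_β + δ_{αβ} - 1} exp ξ(t_β, z)`. -/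
noncomputable def w (τ : Charge N → Ser N) (s : Charge N) (j : ℕ) : Mat N :=
  Matrix.of fun α β => (eps α β s : Fld N) *
    algebraMap (Ser N) (Fld N) (PowerSeries.coeff j
      ((if α = β then 1 else PowerSeries.X) * shift (-1) β (τ (s + root α β)))) /
    algebraMap (Ser N) (Fld N) (τ s)

/-- The operator `∑_{j ≥ 0} w_j(s, t) ∂^{-j}`. -/
noncomputable def What (τ : Charge N → Ser N) (s : Charge N) : Op N :=
  ⟨fun n => if n ≤ 0 then w τ s (-n).toNat else 0, 0, fun _ hn => if_neg (not_le.2 hn)⟩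

/-- The dressing operator `W(s, t, ∂) = What(s, t, ∂) diag(∂^{s_1}, …, ∂^{s_N})`. -/
noncomputable def W (τ : Charge N → Ser N) (s : Charge N) : Op N :=
  What τ s * ∑ β : Fin N, PDO.single (s.1 β) (E β)

/-- `L = W ∂ W⁻¹`. -/
noncomputable def L (τ : Charge N → Ser N) (s : Charge N) : Op N :=
  W τ s * delOp N * Ring.inverse (W τ s)

/-- `R_α = W E_α W⁻¹`. -/
noncomputable def R (τ : Charge N → Ser N) (s : Charge N) (α : Fin N) : Op N :=
  W τ s * PDO.single 0 (E α) * Ring.inverse (W τ s)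

/-- `B_{γ j} = (L^j R_γ)_+`. -/
noncomputable def B (τ : Charge N → Ser N) (s : Charge N) (γ : Fin N) (j : ℕ+) : Op N :=
  (L τ s ^ (j : ℕ) * R τ s γ).diffPart

/-- The matrix `H(s, t)` with diagonal entries `-∂_{t_{κ 1}} log τ(s, t)` and off-diagonal entries
`ε_{λκ}(s) τ(s + e_λ - e_κ, t) / τ(s, t)`. -/
noncomputable def H (τ : Charge N → Ser N) (s : Charge N) : Mat N :=
  Matrix.of fun l k =>
    if l = k then
      -(dt (k, 1) (algebraMap (Ser N) (Fld N) (τ s)) / algebraMap (Ser N) (Fld N) (τ s))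
    else (eps l k s : Fld N) * algebraMap (Ser N) (Fld N) (τ (s + root l k)) /
      algebraMap (Ser N) (Fld N) (τ s)

/-- `P_{α,β} = E_α ∂ + G` with
`G = H(s + e_α - e_β) E_α - E_α H(s) + ∑_{γ ≠ α, β} E_γ`. -/
noncomputable def P (τ : Charge N → Ser N) (s : Charge N) (α β : Fin N) : Op N :=
  PDO.single 1 (E α) + PDO.single 0
    (H τ (s + root α β) * E α - E α * H τ s + ∑ γ with γ ≠ α ∧ γ ≠ β, E γ)

end MultiKP

open MultiKP

/-!
The dressing operator is identified with a left symbol and its inverse with a right symbol, and each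
bilinear identity is read as the vanishing of the negative part of a product of two operators.

For a formal operator `a = ∑ a_i ∂^i` and a family `b_m` of coefficients, the coefficient of `∂⁻¹`
in `a (∑ ∂^m b_m)` is `∑ a_i b_{-1-i}`, the residue of the product of the symbols, by the
Vandermonde identity (`PDO.coeff_mul_ofRight`); and multiplying `∑ ∂^m b_m` by `∂` from the right
applies `z - ∂` to the right symbol (`PDO.ofRight_mul_single_one`). Hence the product is a
differential operator if the residues of `a(z) (z - ∂)^l b(z)` vanish for all `l ≥ 0`
(`PDO.isDiff_mul_ofRight`).

These residues come from the bilinear identity: differentiating it `l` times by `-∑_κ ∂/∂t'_{κ 1}`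
multiplies the exponential factor by `z^l`, and at `t' = t` the factor becomes `1`
(`sum_zcoeff_eq_zero`). A derivation by `∂/∂t_{κ j}` before that replaces the left symbol `a` by
`∂a/∂t_{κ j} + a E_κ z^j` (`sum_zcoeff_pderiv_eq_zero`). The residues are infinite sums
of power series; they converge because the coefficient of `z^k` in the exponential factor contains
only monomials of weight at least `k`, where `t_{κ j}` has weight `j` (`coeff_expXi_mem_wtIdeal`, `coeff_residue`).

Write `V(s)` for the operator whose right symbol is the adjoint wave function.
* With `s' = s` the operator `W(s) V(s)` is differential, and it is `1` up to negative order, so it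
  is `1`. As the monic factor of `W(s)` is not a zero divisor, `V(s) = W(s)⁻¹` (`W_mul_Winv`,
  `Winv_mul_W`).
* After a derivation by `t_{κ j}`, the operator `∂W/∂t_{κ j} W⁻¹ + L^j R_κ` is differential, and its
  first term has negative order, so it is `(L^j R_κ)_+ = B_{κ j}` (`B_eq`).
* For two charges, `W(s + e_α - e_β) W(s)⁻¹` is differential; the coefficients of `∂` and `1` in
  it are computed from the first two coefficients of `What` and identify it with `P_{α,β}(s)`
  (`P_eq`).

All the equations follow from these three facts by algebra in the ring of operators, since `L` and
`R_α` are conjugates of the constant operators `∂` and `E_α` by `W`.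
-/

namespace MultiKP
open Finset

/-! ### Orders, differential operators and simple products -/

namespace PDO
variable {A : Type*} [Ring A] {D : AddDer A}

/-- The operator `a` has order at most `m`. -/
def OrdLE (a : PDO D) (m : ℤ) : Prop := ∀ n, m < n → a.coeff n = 0

/-- The operator `a` is a differential operator: it has no negative powers of `∂`. -/
def IsDiff (a : PDO D) : Prop := ∀ n, n < 0 → a.coeff n = 0

theorem coeff_sub (a b : PDO D) (n : ℤ) : (a - b).coeff n = a.coeff n - b.coeff n := by
  rw [sub_eq_add_neg, coeff_add, coeff_neg, ← sub_eq_add_neg]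

theorem OrdLE.mono {a : PDO D} {m m' : ℤ} (h : OrdLE a m) (hm : m ≤ m') : OrdLE a m' :=
  fun n hn => h n (hm.trans_lt hn)

theorem OrdLE.add {a b : PDO D} {m : ℤ} (ha : OrdLE a m) (hb : OrdLE b m) : OrdLE (a + b) m :=
  fun n hn => by rw [coeff_add, ha n hn, hb n hn, add_zero]

theorem OrdLE.neg {a : PDO D} {m : ℤ} (ha : OrdLE a m) : OrdLE (-a) m :=
  fun n hn => by rw [coeff_neg, ha n hn, neg_zero]

theorem OrdLE.sub {a b : PDO D} {m : ℤ} (ha : OrdLE a m) (hb : OrdLE b m) : OrdLE (a - b) m :=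
  sub_eq_add_neg a b ▸ ha.add hb.neg

theorem OrdLE.mul {a b : PDO D} {m m' : ℤ} (ha : OrdLE a m) (hb : OrdLE b m') :
    OrdLE (a * b) (m + m') :=
  mulCoeff_eq_zero a b ha hb

theorem ordLE_single (n : ℤ) (x : A) : OrdLE (single n x : PDO D) n :=
  fun m hm => by rw [coeff_single, if_neg hm.ne']

theorem ordLE_one : OrdLE (1 : PDO D) 0 := ordLE_single 0 1

/-- Lowering the bound for the order by one when the top coefficient vanishes. -/
theorem OrdLE.pred {a : PDO D} {m : ℤ} (ha : OrdLE a m) (h : a.coeff m = 0) : OrdLE a (m - 1) := by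
  intro n hn
  rcases (show m ≤ n by omega).eq_or_lt with rfl | hlt
  · exact h
  · exact ha n hlt

theorem OrdLE.coeff_mul_top {a b : PDO D} {m m' : ℤ} (ha : OrdLE a m) (hb : OrdLE b m') :
    (a * b).coeff (m + m') = a.coeff m * b.coeff m' := by
  rw [coeff_mul, mulCoeff_eq a b ha hb (r := 0) (by simp) 1 one_pos]
  simp

theorem OrdLE.coeff_mul_subtop {a b : PDO D} {m m' : ℤ} (ha : OrdLE a m) (hb : OrdLE b m')
    (h : D (b.coeff m') = 0) :
    (a * b).coeff (m + m' - 1) =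
      a.coeff m * b.coeff (m' - 1) + a.coeff (m - 1) * b.coeff m' := by
  rw [coeff_mul, mulCoeff_eq a b ha hb (r := 1) (by simp) 2 one_lt_two]
  simp [sum_range_succ, h]

theorem IsDiff.add {a b : PDO D} (ha : IsDiff a) (hb : IsDiff b) : IsDiff (a + b) :=
  fun n hn => by rw [coeff_add, ha n hn, hb n hn, add_zero]

theorem IsDiff.neg {a : PDO D} (ha : IsDiff a) : IsDiff (-a) :=
  fun n hn => by rw [coeff_neg, ha n hn, neg_zero]

theorem IsDiff.sub {a b : PDO D} (ha : IsDiff a) (hb : IsDiff b) : IsDiff (a - b) :=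
  sub_eq_add_neg a b ▸ ha.add hb.neg

theorem isDiff_single {n : ℤ} (hn : 0 ≤ n) (x : A) : IsDiff (single n x : PDO D) :=
  fun m hm => by rw [coeff_single, if_neg (by omega)]

theorem IsDiff.mul {a b : PDO D} (ha : IsDiff a) (hb : IsDiff b) : IsDiff (a * b) := by
  intro n hn
  refine finsum_eq_zero_of_forall_eq_zero fun ⟨i, k⟩ => ?_
  dsimp only
  rcases lt_or_ge i 0 with hi | hi
  · rw [ha i hi, zero_mul, smul_zero]
  rcases lt_or_ge (n - i + k) 0 with hk | hk
  · rw [hb _ hk, D.iter_zero, mul_zero, smul_zero]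
  · lift i to ℕ using hi
    rw [Ring.choose_natCast, Nat.choose_eq_zero_of_lt (by omega), Nat.cast_zero, zero_smul]

/-- A differential operator of negative order vanishes. -/
theorem IsDiff.eq_zero {a : PDO D} (ha : IsDiff a) (h : OrdLE a (-1)) : a = 0 := by
  ext n
  rcases lt_or_ge n 0 with hn | hn
  · exact ha n hn
  · exact h n (by omega)

theorem IsDiff.diffPart_eq {a b : PDO D} (hb : IsDiff b) (h : OrdLE (a - b) (-1)) :
    a.diffPart = b := by
  ext n
  change (if 0 ≤ n then a.coeff n else 0) = _
  split_ifs with hn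
  · have := h n (by omega)
    rwa [coeff_sub, sub_eq_zero] at this
  · exact (hb n (by omega)).symm

theorem coeff_single_zero_mul (x : A) (a : PDO D) (n : ℤ) :
    (single 0 x * a).coeff n = x * a.coeff n := by
  rw [coeff_mul, mulCoeff, finsum_eq_single _ ((0 : ℤ), 0)]
  · simp [coeff_single]
  · rintro ⟨i, k⟩ h
    by_cases hi : i = 0
    · subst hi
      have hk : 0 < k := Nat.pos_of_ne_zero fun hk => h (by rw [hk])
      rw [Ring.choose_zero_pos ℤ hk, zero_smul]
    · simp [coeff_single, hi]

theorem iter_eq_zero {x : A} (hx : D x = 0) (k : ℕ) : D^[k + 1] x = 0 := by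
  rw [Function.iterate_succ_apply, hx, D.iter_zero]

theorem coeff_mul_single (a : PDO D) {x : A} (hx : D x = 0) (m n : ℤ) :
    (a * single m x).coeff n = a.coeff (n - m) * x := by
  rw [coeff_mul, mulCoeff, finsum_eq_single _ (n - m, 0)]
  · simp [coeff_single]
  · rintro ⟨i, k⟩ h
    rcases k with _ | k
    · have hi : n - i ≠ m := fun hi => h (by rw [← hi, sub_sub_cancel])
      simp [coeff_single, hi]
    · simp only [coeff_single]
      split_ifs
      · rw [iter_eq_zero hx, mul_zero, smul_zero]
      · rw [D.iter_zero, mul_zero, smul_zero]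

theorem single_mul_single (x : A) {y : A} (hy : D y = 0) (m n : ℤ) :
    (single m x * single n y : PDO D) = single (m + n) (x * y) := by
  ext i
  rw [coeff_mul_single _ hy, coeff_single, coeff_single]
  by_cases h : i = m + n
  · rw [if_pos h, if_pos (by omega)]
  · rw [if_neg h, if_neg (by omega), zero_mul]

theorem single_zero_mul_single (x y : A) (n : ℤ) :
    (single 0 x * single n y : PDO D) = single n (x * y) := by
  ext i
  rw [coeff_single_zero_mul, coeff_single, coeff_single, mul_ite, mul_zero]

theorem single_one_pow (j : ℕ) : (single 1 1 : PDO D) ^ j = single j 1 := by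
  induction j with
  | zero => rfl
  | succ j ih =>
    rw [pow_succ, ih, single_mul_single _ D.map_one, mul_one, Nat.cast_succ]

/-! ### Left and right inverses of monic operators of order zero -/

/-- An operator `1 + ∑_{n < 0} a_n ∂ⁿ` is not a left zero divisor. -/
theorem eq_zero_of_monic_mul {a x : PDO D} (ha : OrdLE (a - 1) (-1)) (h : a * x = 0) : x = 0 := by
  obtain ⟨m, hm⟩ := x.bdd'
  have key : ∀ k : ℕ, OrdLE x (m - k) := by
    intro k
    induction k with
    | zero => simpa [OrdLE] using hm
    | succ k ih =>
      have : x = -((a - 1) * x) := by rw [sub_mul, h, one_mul, zero_sub, neg_neg]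
      rw [this]
      exact ((ha.mul ih).mono (by push_cast; omega)).neg
  ext n
  exact key (m - n + 1).toNat n (by omega)

theorem mul_eq_one_of_monic {a b : PDO D} (ha : OrdLE (a - 1) (-1)) (h : a * b = 1) :
    b * a = 1 := by
  have h2 : a * (b * a - 1) = 0 := by rw [mul_sub, ← mul_assoc, h, one_mul, mul_one, sub_self]
  exact sub_eq_zero.1 (eq_zero_of_monic_mul ha h2)

/-! ### Coefficientwise derivations -/

theorem coeff_mapCoeff (f : A →+ A) (a : PDO D) (n : ℤ) : (mapCoeff f a).coeff n = f (a.coeff n) :=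
  rfl

theorem mapCoeff_add (f : A →+ A) (a b : PDO D) :
    mapCoeff f (a + b) = mapCoeff f a + mapCoeff f b := by
  ext n
  simp only [coeff_mapCoeff, coeff_add, map_add]

theorem mapCoeff_single (f : A →+ A) (n : ℤ) (x : A) :
    mapCoeff f (single n x : PDO D) = single n (f x) := by
  ext i
  simp only [coeff_mapCoeff, coeff_single]
  split_ifs <;> simp

theorem mapCoeff_sum {ι : Type*} (f : A →+ A) (s : Finset ι) (a : ι → PDO D) :
    mapCoeff f (∑ i ∈ s, a i) = ∑ i ∈ s, mapCoeff f (a i) := by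
  induction s using Finset.cons_induction with
  | empty => ext n; exact map_zero f
  | cons i s hi ih => rw [sum_cons, sum_cons, mapCoeff_add, ih]

theorem iter_comm {D' : AddDer A} (hc : ∀ x, D' (D x) = D (D' x)) (k : ℕ) (x : A) :
    D' (D^[k] x) = D^[k] (D' x) :=
  (Function.Commute.iterate_right (f := D') (g := D) hc k) x

theorem mapCoeff_mul {D' : AddDer A} (hc : ∀ x, D' (D x) = D (D' x)) (a b : PDO D) :
    mapCoeff D'.toHom (a * b) = a * mapCoeff D'.toHom b + mapCoeff D'.toHom a * b := by
  obtain ⟨M, ha, hb, -⟩ := exists_bdd₃ a b b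
  have ha' : OrdLE (mapCoeff D'.toHom a) M := fun n hn => by rw [coeff_mapCoeff, ha n hn, map_zero]
  have hb' : OrdLE (mapCoeff D'.toHom b) M := fun n hn => by rw [coeff_mapCoeff, hb n hn, map_zero]
  ext n
  rw [coeff_mapCoeff, coeff_add]
  rcases lt_or_ge (M + M) n with h | h
  · rw [OrdLE.mul ha hb n h, OrdLE.mul ha hb' n h, OrdLE.mul ha' hb n h, map_zero, add_zero]
  obtain ⟨r, hr⟩ := Int.eq_ofNat_of_zero_le (sub_nonneg.2 h)
  have hr : n = M + M - r := by omega
  rw [coeff_mul, coeff_mul, coeff_mul, mulCoeff_eq _ _ ha hb hr (r + 1) (by omega),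
    mulCoeff_eq _ _ ha hb' hr (r + 1) (by omega), mulCoeff_eq _ _ ha' hb hr (r + 1) (by omega)]
  simp only [map_sum, ← sum_add_distrib]
  refine sum_congr rfl fun u _ => sum_congr rfl fun v _ => sum_congr rfl fun k _ => ?_
  split_ifs
  · rw [map_zsmul, D'.leibniz', iter_comm hc, smul_add]
    rfl
  · rw [map_zero, add_zero]

/-! ### Operators with coefficients on the right -/

theorem sum_choose_mul_choose (i : ℤ) (r : ℕ) (f : ℕ → A) :
    ∑ p ∈ antidiagonal r,
      (Ring.choose i p.1 * Ring.choose (-1 - i + r : ℤ) p.2) • f r = if r = 0 then f r else 0 := by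
  rw [← sum_smul, ← Ring.add_choose_eq r (Commute.all _ _)]
  have h : i + (-1 - i + r) = (r : ℤ) - 1 := by ring
  rw [h]
  rcases r with _ | r
  · simp
  · have : ((r + 1 : ℕ) : ℤ) - 1 = (r : ℕ) := by push_cast; ring
    rw [this, Ring.choose_natCast, Nat.choose_succ_self]
    simp

/-- The operator `∑_m ∂^m b_m`, for the family `b` of coefficients of a formal operator. -/
noncomputable def ofRight (b : PDO D) : PDO D where
  coeff n := ∑ᶠ k : ℕ, Ring.choose (n + k : ℤ) k • D^[k] (b.coeff (n + k))
  bdd' := by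
    obtain ⟨m, hm⟩ := b.bdd'
    refine ⟨m, fun n hn => finsum_eq_zero_of_forall_eq_zero fun k => ?_⟩
    rw [hm _ (by omega), D.iter_zero, smul_zero]

theorem coeff_ofRight {b : PDO D} {M : ℤ} (hb : OrdLE b M) (n : ℤ) (S : ℕ) (hS : M < n + S) :
    (ofRight b).coeff n = ∑ k ∈ range S, Ring.choose (n + k : ℤ) k • D^[k] (b.coeff (n + k)) := by
  refine finsum_eq_sum_of_support_subset _ fun k hk => ?_
  by_contra h
  simp only [coe_range, Set.mem_Iio, not_lt] at h
  exact hk (by dsimp only; rw [hb _ (by omega), D.iter_zero, smul_zero])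

/-- The coefficients of `(∑_m ∂^m b_m) ∂`, written on the right. -/
def rightShift (b : PDO D) : PDO D where
  coeff n := b.coeff (n - 1) - D (b.coeff n)
  bdd' := by
    obtain ⟨m, hm⟩ := b.bdd'
    exact ⟨m + 1, fun n hn => by rw [hm _ (by omega), hm _ (by omega), map_zero, sub_zero]⟩

theorem OrdLE.rightShift {b : PDO D} {M : ℤ} (hb : OrdLE b M) : OrdLE (rightShift b) (M + 1) :=
  fun n hn => by
    change b.coeff (n - 1) - D (b.coeff n) = 0
    rw [hb _ (by omega), hb _ (by omega), map_zero, sub_zero]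

theorem ofRight_mul_single_one (b : PDO D) :
    ofRight b * single 1 1 = ofRight (rightShift b) := by
  obtain ⟨M, hM⟩ := b.bdd'
  have hM' := OrdLE.rightShift hM
  ext n
  have hS : M + 1 < n + ((M + 1 - n).toNat + 1 : ℕ) := by push_cast; omega
  set S := (M + 1 - n).toNat + 1
  rw [coeff_mul_single _ D.map_one, mul_one,
    coeff_ofRight hM _ (S + 1) (by push_cast at hS ⊢; omega),
    coeff_ofRight hM' n (S + 1) (by push_cast at hS ⊢; omega)]
  change _ = ∑ k ∈ range (S + 1), Ring.choose (n + k : ℤ) k •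
    D.iter k (b.coeff (n + k - 1) - D (b.coeff (n + k)))
  simp only [map_sub, smul_sub, sum_sub_distrib, AddDer.iter_apply, ← Function.iterate_succ_apply]
  -- the last term of the subtracted sum vanishes, and the others pair up by Pascal's rule
  have hlast : Ring.choose (n + S : ℤ) S • D^[S + 1] (b.coeff (n + S)) = 0 := by
    rw [hM _ (by omega), D.iter_zero, smul_zero]
  rw [sum_range_succ (fun k : ℕ => Ring.choose (n + k : ℤ) k • D^[k + 1] (b.coeff (n + k))), hlast,
    add_zero, sum_range_succ', sum_range_succ' (fun k : ℕ => Ring.choose (n + k : ℤ) k •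
      D^[k] (b.coeff (n + k - 1))), eq_sub_iff_add_eq, add_right_comm, ← sum_add_distrib]
  congr 1
  · refine sum_congr rfl fun k _ => ?_
    have h1 : n - 1 + ((k + 1 : ℕ) : ℤ) = n + k := by push_cast; ring
    have h2 : n + ((k + 1 : ℕ) : ℤ) = n + k + 1 := by push_cast; ring
    rw [h1, h2, Ring.choose_succ_succ, add_sub_cancel_right, ← add_smul, add_comm]
  · simp

/-- The inner sum in the residue of `a (∑_m ∂^m b_m)`, a case of the Vandermonde identity. -/
theorem sum_choose_ofRight {b : PDO D} {M : ℤ} (hb : OrdLE b M) (i : ℤ) (S : ℕ)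
    (hS : M < -1 - i + S) :
    ∑ k ∈ range S, Ring.choose i k • D^[k] ((ofRight b).coeff (-1 - i + k)) = b.coeff (-1 - i) := by
  set f : ℕ → A := fun r => D^[r] (b.coeff (-1 - i + r)) with hf
  have hzero : ∀ r, S ≤ r → f r = 0 := fun r hr => by
    rw [hf]
    dsimp only
    rw [hb _ (by omega), D.iter_zero]
  have h1 : ∀ k ∈ range S, Ring.choose i k • D^[k] ((ofRight b).coeff (-1 - i + k)) =
      ∑ l ∈ range S, (Ring.choose i k * Ring.choose (-1 - i + (k + l : ℕ) : ℤ) l) • f (k + l) := by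
    intro k _
    rw [coeff_ofRight hb _ S (by omega), ← D.iter_apply, map_sum, smul_sum]
    refine sum_congr rfl fun l _ => ?_
    rw [map_zsmul, D.iter_apply, ← Function.iterate_add_apply, smul_smul, hf]
    dsimp only
    rw [Nat.cast_add, ← add_assoc]
  have h2 : ∀ r ∈ range S, (if r = 0 then f r else 0) = ∑ p ∈ antidiagonal r,
      (Ring.choose i p.1 * Ring.choose (-1 - i + (p.1 + p.2 : ℕ) : ℤ) p.2) • f (p.1 + p.2) := by
    intro r _
    rw [← sum_choose_mul_choose i r f]
    refine sum_congr rfl fun p hp => ?_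
    rw [mem_antidiagonal.1 hp]
  rw [sum_congr rfl h1]
  trans ∑ r ∈ range S, if r = 0 then f r else 0
  · rw [sum_congr rfl h2, ← sum_product', sum_sigma']
    symm
    refine sum_of_injOn (fun x => x.2) ?_ ?_ ?_ ?_
    · rintro ⟨r, p⟩ h ⟨r', p'⟩ h' e
      simp only [coe_sigma, Set.mem_sigma_iff, mem_coe,
        HasAntidiagonal.mem_antidiagonal] at h h' e
      subst e
      obtain rfl : r = r' := h.2.symm.trans h'.2
      rfl
    · rintro ⟨r, p⟩ h
      simp only [coe_sigma, Set.mem_sigma_iff, mem_coe, HasAntidiagonal.mem_antidiagonal,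
        mem_range] at h
      simp only [mem_coe, mem_product, mem_range]
      omega
    · rintro ⟨k, l⟩ _ h
      dsimp only
      rw [hzero (k + l), smul_zero]
      by_contra hlt
      exact h ⟨⟨k + l, (k, l)⟩, by simp at hlt ⊢; exact hlt, rfl⟩
    · intro x _
      rfl
  · rw [sum_ite_eq']
    split_ifs with h
    · simp [hf]
    · rw [hb]
      simp at h
      subst h
      simpa using hS

/-- The residue (the coefficient of `∂⁻¹`) of `(∑_i a_i ∂^i) (∑_m ∂^m b_m)` is
`∑_i a_i b_{-1-i}`. -/
theorem coeff_mul_ofRight {a b : PDO D} {M M' : ℤ} (ha : OrdLE a M) (hb : OrdLE b M') :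
    (a * ofRight b).coeff (-1) = ∑ i ∈ Icc (-1 - M') M, a.coeff i * b.coeff (-1 - i) := by
  have hR : OrdLE (ofRight b) M' := fun n hn => finsum_eq_zero_of_forall_eq_zero fun k => by
    rw [hb _ (by omega), D.iter_zero, smul_zero]
  set S := (M + M' + 2).toNat with hS
  trans ∑ p ∈ Icc (-1 - M') M ×ˢ range S,
      Ring.choose p.1 p.2 • (a.coeff p.1 * D^[p.2] ((ofRight b).coeff (-1 - p.1 + p.2)))
  · rw [coeff_mul, mulCoeff]
    refine finsum_eq_sum_of_support_subset _ ?_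
    rintro ⟨i, k⟩ hp
    by_contra h
    refine hp ?_
    dsimp only
    by_cases hi : i ≤ M
    · rw [hR, D.iter_zero, mul_zero, smul_zero]
      simp only [coe_product, Set.mem_prod, mem_coe, mem_Icc, mem_range] at h
      omega
    · rw [ha _ (by omega), zero_mul, smul_zero]
  · rw [sum_product]
    refine sum_congr rfl fun i hi => ?_
    rw [mem_Icc] at hi
    rw [← sum_choose_ofRight hb i S (by omega), mul_sum]
    exact sum_congr rfl fun k _ => (mul_smul_comm _ _ _).symm

/-- `a (∑_m ∂^m b_m)` is a differential operator as soon as all the residues of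
`a (∑_m ∂^m b_m) ∂^l` vanish. -/
theorem isDiff_mul_ofRight {a b : PDO D}
    (h : ∀ l : ℕ, (a * ofRight (rightShift^[l] b)).coeff (-1) = 0) : IsDiff (a * ofRight b) := by
  have key : ∀ l : ℕ, ofRight b * single 1 1 ^ l = ofRight (rightShift^[l] b) := by
    intro l
    induction l with
    | zero => rw [pow_zero, mul_one]; rfl
    | succ l ih => rw [pow_succ, ← mul_assoc, ih, ofRight_mul_single_one,
        Function.iterate_succ_apply']
  intro n hn
  have := h (-1 - n).toNat
  rw [← key, single_one_pow, ← mul_assoc, coeff_mul_single _ D.map_one, mul_one] at this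
  convert this using 2
  omega

end PDO

/-! ### Integer-indexed coefficients of power series in `z⁻¹` -/

section LaurentCoefficients
variable {S : Type*} [CommRing S]

/-- The coefficient of index `n ∈ ℤ` of a power series, zero for `n < 0`. In terms of a power series
`p` in `z⁻¹`, the coefficient of `z^m` in `z^n p` is `zcoeff (n - m) p`. -/
noncomputable def zcoeff (n : ℤ) : PowerSeries S →+ S where
  toFun p := if 0 ≤ n then PowerSeries.coeff n.toNat p else 0
  map_zero' := by simp
  map_add' p q := by split_ifs <;> simp

theorem zcoeff_of_nonneg {n : ℤ} (hn : 0 ≤ n) (p : PowerSeries S) :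
    zcoeff n p = PowerSeries.coeff n.toNat p := if_pos hn

theorem zcoeff_of_neg {n : ℤ} (hn : n < 0) (p : PowerSeries S) : zcoeff n p = 0 :=
  if_neg (by omega)

theorem zcoeff_natCast (n : ℕ) (p : PowerSeries S) :
    zcoeff (n : ℤ) p = PowerSeries.coeff n p := zcoeff_of_nonneg (by omega) p

/-- `z^{n + j} (z^{-j} p) = z^n p`, where the variable `X` stands for `z⁻¹`. -/
theorem zcoeff_X_pow_mul (n : ℤ) (j : ℕ) (p : PowerSeries S) :
    zcoeff (n + j) (PowerSeries.X ^ j * p) = zcoeff n p := by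
  rcases lt_or_ge (n + j) 0 with h | h
  · rw [zcoeff_of_neg h, zcoeff_of_neg (by omega)]
  lift n + j to ℕ using h with m hm
  rw [zcoeff_natCast, PowerSeries.coeff_X_pow_mul']
  split_ifs with hj
  · rw [zcoeff_of_nonneg (by omega)]
    congr 2
    omega
  · rw [zcoeff_of_neg (by omega)]

theorem zcoeff_X_mul (n : ℤ) (p : PowerSeries S) :
    zcoeff (n + 1) (PowerSeries.X * p) = zcoeff n p := by
  simpa using zcoeff_X_pow_mul n 1 p

theorem zcoeff_map {S' : Type*} [CommRing S'] (f : S →+* S') (n : ℤ) (p : PowerSeries S) :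
    zcoeff n (PowerSeries.map f p) = f (zcoeff n p) := by
  rcases lt_or_ge n 0 with h | h
  · rw [zcoeff_of_neg h, zcoeff_of_neg h, map_zero]
  · rw [zcoeff_of_nonneg h, zcoeff_of_nonneg h, PowerSeries.coeff_map]

/-- The residue of `z^m p(z⁻¹) z^n q(z⁻¹)`. -/
theorem sum_zcoeff_mul_zcoeff (m n : ℤ) (p q : PowerSeries S) (a b : ℤ)
    (ha : ∀ i, i < a → zcoeff (n - (-1 - i)) q = 0) (hb : ∀ i, b < i → zcoeff (m - i) p = 0) :
    ∑ i ∈ Icc a b, zcoeff (m - i) p * zcoeff (n - (-1 - i)) q = zcoeff (m + n + 1) (p * q) := by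
  have hfin : ∑ i ∈ Icc a b, zcoeff (m - i) p * zcoeff (n - (-1 - i)) q =
      ∑ i ∈ Icc (-1 - n) m, zcoeff (m - i) p * zcoeff (n - (-1 - i)) q := by
    rw [← finsum_eq_sum_of_support_subset, ← finsum_eq_sum_of_support_subset]
    · intro i hi
      by_contra h
      rw [mem_coe, mem_Icc, not_and_or] at h
      refine hi ?_
      dsimp only
      rcases h with h | h
      · rw [zcoeff_of_neg (n := n - (-1 - i)) (by omega), mul_zero]
      · rw [zcoeff_of_neg (n := m - i) (by omega), zero_mul]
    · intro i hi
      by_contra h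
      rw [mem_coe, mem_Icc, not_and_or] at h
      refine hi ?_
      dsimp only
      rcases h with h | h
      · rw [ha i (by omega), mul_zero]
      · rw [hb i (by omega), zero_mul]
  rw [hfin]
  rcases lt_or_ge (m + n + 1) 0 with h | h
  · rw [zcoeff_of_neg h, Icc_eq_empty (by omega), sum_empty]
  · rw [zcoeff_of_nonneg h, PowerSeries.coeff_mul]
    refine sum_nbij' (fun i => ((m - i).toNat, (n + 1 + i).toNat)) (fun x => m - x.1) ?_ ?_ ?_ ?_ ?_
    · intro i hi
      rw [mem_Icc] at hi
      rw [HasAntidiagonal.mem_antidiagonal]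
      omega
    · intro x hx
      rw [HasAntidiagonal.mem_antidiagonal] at hx
      rw [mem_Icc]
      omega
    · intro i hi
      rw [mem_Icc] at hi
      dsimp only
      omega
    · rintro ⟨x, y⟩ hx
      rw [HasAntidiagonal.mem_antidiagonal] at hx
      dsimp only at hx ⊢
      ext <;> dsimp only <;> omega
    · intro i hi
      rw [mem_Icc] at hi
      rw [zcoeff_of_nonneg (by omega), zcoeff_of_nonneg (by omega)]
      congr 3
      omega

variable [Algebra ℂ S]

/-- A derivation of the coefficient ring, applied to every coefficient of a power series. -/
noncomputable def coeffDer (d : Derivation ℂ S S) :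
    Derivation ℂ (PowerSeries S) (PowerSeries S) where
  toFun p := PowerSeries.mk fun n => d (PowerSeries.coeff n p)
  map_add' p q := by ext n; simp
  map_smul' c p := by ext n; simp
  map_one_eq_zero' := by
    ext n
    simp only [LinearMap.coe_mk, AddHom.coe_mk, PowerSeries.coeff_mk, PowerSeries.coeff_one,
      map_zero]
    split_ifs <;> simp
  leibniz' p q := by
    ext n
    simp only [LinearMap.coe_mk, AddHom.coe_mk, PowerSeries.coeff_mk, PowerSeries.coeff_mul,
      map_sum, d.leibniz, map_add, smul_eq_mul, sum_add_distrib]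
    congr 1
    rw [← Finset.Nat.sum_antidiagonal_swap]
    rfl

theorem coeff_coeffDer (d : Derivation ℂ S S) (n : ℕ) (p : PowerSeries S) :
    PowerSeries.coeff n (coeffDer d p) = d (PowerSeries.coeff n p) := by
  change PowerSeries.coeff n (PowerSeries.mk fun n => d (PowerSeries.coeff n p)) = _
  rw [PowerSeries.coeff_mk]

theorem zcoeff_coeffDer (d : Derivation ℂ S S) (n : ℤ) (p : PowerSeries S) :
    zcoeff n (coeffDer d p) = d (zcoeff n p) := by
  rcases lt_or_ge n 0 with h | h
  · rw [zcoeff_of_neg h, zcoeff_of_neg h, map_zero]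
  · rw [zcoeff_of_nonneg h, zcoeff_of_nonneg h, coeff_coeffDer]

end LaurentCoefficients

/-! ### Weights and the exponential factor -/

section Residues
variable {N : ℕ}

/-- The weight of the time variables `t_{γ j}` and `t'_{γ j}` is `j`. -/
def wt : TimeIdx N ⊕ TimeIdx N → ℕ := Sum.elim (fun p => p.2) (fun p => p.2)

/-- The series all of whose monomials have weight at least `k`. -/
def wtIdeal (k : ℕ) : Submodule ℂ (Ser₂ N) where
  carrier := {f | (k : ℕ∞) ≤ f.weightedOrder wt}
  zero_mem' := by simp
  add_mem' {f g} hf hg := (le_min hf hg).trans (MvPowerSeries.min_weightedOrder_le_add wt)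
  smul_mem' c f hf := le_trans hf (MvPowerSeries.le_weightedOrder_smul wt)

theorem mem_wtIdeal {k : ℕ} {f : Ser₂ N} :
    f ∈ wtIdeal k ↔ (k : ℕ∞) ≤ f.weightedOrder wt := Iff.rfl

theorem coeff_eq_zero_of_mem_wtIdeal {k : ℕ} {f : Ser₂ N} (hf : f ∈ wtIdeal k)
    {d : TimeIdx N ⊕ TimeIdx N →₀ ℕ} (hd : Finsupp.weight wt d < k) :
    MvPowerSeries.coeff d f = 0 :=
  MvPowerSeries.coeff_eq_zero_of_lt_weightedOrder wt
    (lt_of_lt_of_le (by exact_mod_cast hd) hf)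

theorem mul_mem_wtIdeal {k l : ℕ} {f g : Ser₂ N} (hf : f ∈ wtIdeal k) (hg : g ∈ wtIdeal l) :
    f * g ∈ wtIdeal (k + l) := by
  rw [mem_wtIdeal] at *
  rw [Nat.cast_add]
  exact (add_le_add hf hg).trans (MvPowerSeries.le_weightedOrder_mul wt)

theorem X_mem_wtIdeal (i : TimeIdx N ⊕ TimeIdx N) :
    (MvPowerSeries.X i : Ser₂ N) ∈ wtIdeal (wt i) := by
  rw [mem_wtIdeal, MvPowerSeries.X, MvPowerSeries.weightedOrder_monomial_of_ne_zero wt one_ne_zero]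
  simp [Finsupp.weight_apply]

theorem constantCoeff_xi (γ : Fin N) : PowerSeries.constantCoeff (xi γ) = 0 := by
  rw [← PowerSeries.coeff_zero_eq_constantCoeff_apply, xi, PowerSeries.coeff_mk, dif_neg (by simp)]

theorem coeff_xi (γ : Fin N) (j : ℕ+) : PowerSeries.coeff (j : ℕ) (xi γ) =
    MvPowerSeries.X (Sum.inl (γ, j)) - MvPowerSeries.X (Sum.inr (γ, j)) := by
  rw [xi, PowerSeries.coeff_mk, dif_pos j.pos]
  rfl

theorem coeff_xi_mem_wtIdeal (γ : Fin N) (k : ℕ) : PowerSeries.coeff k (xi γ) ∈ wtIdeal k := by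
  rcases Nat.eq_zero_or_pos k with rfl | hk
  · rw [PowerSeries.coeff_zero_eq_constantCoeff_apply, constantCoeff_xi]
    exact zero_mem _
  · lift k to ℕ+ using hk
    rw [coeff_xi]
    exact sub_mem (X_mem_wtIdeal (Sum.inl (γ, k))) (X_mem_wtIdeal (Sum.inr (γ, k)))

theorem coeff_xi_pow_mem_wtIdeal (γ : Fin N) (n k : ℕ) :
    PowerSeries.coeff k (xi γ ^ n) ∈ wtIdeal k := by
  induction n generalizing k with
  | zero =>
    rw [pow_zero, PowerSeries.coeff_one]
    split_ifs with h
    · subst h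
      rw [mem_wtIdeal]
      simp
    · exact zero_mem _
  | succ n ih =>
    rw [pow_succ, PowerSeries.coeff_mul]
    refine sum_mem fun p hp => ?_
    rw [← HasAntidiagonal.mem_antidiagonal.1 hp]
    exact mul_mem_wtIdeal (ih p.1) (coeff_xi_mem_wtIdeal γ p.2)

/-- The coefficients of `exp ξ(t_γ - t'_γ, z)` as finite sums. -/
theorem coeff_expXi (γ : Fin N) (k n : ℕ) (hn : k ≤ n) : PowerSeries.coeff k (expXi γ) =
    ∑ m ∈ range (n + 1), (1 / (m.factorial : ℂ)) • PowerSeries.coeff k (xi γ ^ m) := by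
  rw [expXi, PowerSeries.coeff_subst' (PowerSeries.HasSubst.of_constantCoeff_zero'
    (constantCoeff_xi γ))]
  simp only [PowerSeries.coeff_exp]
  have hc : ∀ m : ℕ, algebraMap ℚ ℂ (1 / (m.factorial : ℚ)) = 1 / (m.factorial : ℂ) :=
    fun m => by simp
  simp only [hc]
  refine finsum_eq_sum_of_support_subset _ fun m hm => ?_
  by_contra h
  simp only [coe_range, Set.mem_Iio, not_lt] at h
  refine hm ?_
  dsimp only
  rw [PowerSeries.coeff_of_lt_order k, smul_zero]
  refine lt_of_lt_of_le ?_
    (PowerSeries.le_order_pow_of_constantCoeff_eq_zero m (constantCoeff_xi γ))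
  exact_mod_cast (by omega : k < m)

theorem coeff_expXi_mem_wtIdeal (γ : Fin N) (k : ℕ) :
    PowerSeries.coeff k (expXi γ) ∈ wtIdeal k := by
  rw [coeff_expXi γ k k le_rfl]
  exact sum_mem fun m _ => Submodule.smul_mem _ _ (coeff_xi_pow_mem_wtIdeal γ m k)

/-- If a derivation maps `ξ(t_γ - t'_γ, z)` to `c z^j`, then it maps its exponential to `c z^j`
times the exponential. -/
theorem coeffDer_expXi {d : Derivation ℂ (Ser₂ N) (Ser₂ N)} {γ : Fin N} {c : ℂ} {j : ℕ}
    (hd : coeffDer d (xi γ) = c • PowerSeries.X ^ j) :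
    coeffDer d (expXi γ) = c • (PowerSeries.X ^ j * expXi γ) := by
  ext1 k
  have hpow : ∀ m : ℕ, d (PowerSeries.coeff k (xi γ ^ m)) =
      m • c • PowerSeries.coeff k (PowerSeries.X ^ j * xi γ ^ (m - 1)) := by
    intro m
    rw [← coeff_coeffDer, Derivation.leibniz_pow, hd, map_nsmul, smul_eq_mul, mul_smul_comm,
      mul_comm, PowerSeries.coeff_smul]
  have hsmul : ∀ (b : ℂ) (f : Ser₂ N), d (b • f) = b • d f := fun b f => d.map_smul b f
  rw [coeff_coeffDer, coeff_expXi γ k (k + 1) (by omega), map_sum]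
  simp only [hsmul, hpow]
  rw [sum_range_succ', zero_smul, smul_zero, add_zero, PowerSeries.coeff_smul,
    PowerSeries.coeff_X_pow_mul']
  simp only [PowerSeries.coeff_X_pow_mul', Nat.add_sub_cancel]
  split_ifs with hj
  · rw [coeff_expXi γ (k - j) k (by omega), smul_sum]
    refine sum_congr rfl fun m _ => ?_
    rw [← Nat.cast_smul_eq_nsmul ℂ, smul_smul, smul_smul, smul_smul]
    congr 1
    rw [Nat.factorial_succ]
    have := Nat.factorial_ne_zero m
    push_cast
    field_simp
  · simp

end Residues

/-! ### Partial derivatives and renaming of variables -/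

section Rename
variable {σ τ : Type*} (f : σ → τ) [Filter.TendstoCofinite f]

theorem pderiv_rename (hf : Function.Injective f) (i : σ) (p : MvPowerSeries σ ℂ) :
    MvPowerSeries.pderiv ℂ (f i) (MvPowerSeries.rename f p) =
      MvPowerSeries.rename f (MvPowerSeries.pderiv ℂ i p) := by
  have hcoeff : ∀ (q : MvPowerSeries σ ℂ) (x : σ →₀ ℕ),
      MvPowerSeries.coeff (x.mapDomain f) (MvPowerSeries.rename f q) = MvPowerSeries.coeff x q :=
    fun q x => by
      have := MvPowerSeries.coeff_embDomain_rename ⟨f, hf⟩ q x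
      rwa [Finsupp.embDomain_eq_mapDomain] at this
  ext d
  rw [MvPowerSeries.coeff_pderiv]
  by_cases hd : d ∈ Set.range (Finsupp.mapDomain f)
  · obtain ⟨x, rfl⟩ := hd
    have h1 : x.mapDomain f + Finsupp.single (f i) 1 = (x + Finsupp.single i 1).mapDomain f := by
      rw [Finsupp.mapDomain_add, Finsupp.mapDomain_single]
    rw [h1, hcoeff, hcoeff, MvPowerSeries.coeff_pderiv, Finsupp.mapDomain_apply hf]
  · rw [MvPowerSeries.coeff_rename_eq_zero f _ hd, MvPowerSeries.coeff_rename_eq_zero, zero_mul]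
    rw [Finsupp.mem_range_mapDomain_iff f hf] at hd ⊢
    refine fun h => hd fun t ht => ?_
    have := h t ht
    simp only [Finsupp.add_apply, Nat.add_eq_zero_iff] at this
    exact this.1

theorem pderiv_rename_of_notMem_range (hf : Function.Injective f) {t : τ} (ht : t ∉ Set.range f)
    (p : MvPowerSeries σ ℂ) :
    MvPowerSeries.pderiv ℂ t (MvPowerSeries.rename f p) = 0 := by
  ext d
  rw [MvPowerSeries.coeff_pderiv, MvPowerSeries.coeff_rename_eq_zero, zero_mul, map_zero]
  rw [Finsupp.mem_range_mapDomain_iff f hf]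
  intro h
  simpa using h t ht

end Rename

section Residues
variable {N : ℕ}

/-! ### Derivatives of residues and their restriction to the diagonal -/

/-- Only finitely many terms of a residue contribute to the coefficient of a given monomial. -/
theorem coeff_residue (γ : Fin N) (n : ℤ) (p : PowerSeries (Ser₂ N))
    (d : TimeIdx N ⊕ TimeIdx N →₀ ℕ) (K : ℕ) (hK : Finsupp.weight wt d < K) :
    MvPowerSeries.coeff d (residue n (expXi γ) p) = ∑ k ∈ range K,
      MvPowerSeries.coeff d (PowerSeries.coeff k (expXi γ) * zcoeff (n + 1 + k) p) := by
  set T : Finset (ℕ × ℕ) := (range K).image fun k => (k, (n + 1 + k).toNat) with hT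
  set g : ℕ × ℕ → ℂ := fun q => if n + q.1 - q.2 = -1 then
    MvPowerSeries.coeff d (PowerSeries.coeff q.1 (expXi γ) * PowerSeries.coeff q.2 p) else 0 with hg
  have h0 : ∀ q : ℕ × ℕ, K ≤ q.1 → g q = 0 := by
    intro q hq
    rw [hg]
    dsimp only
    split_ifs
    · have h1 : PowerSeries.coeff q.2 p ∈ wtIdeal 0 := by simp [mem_wtIdeal]
      exact coeff_eq_zero_of_mem_wtIdeal (mul_mem_wtIdeal (coeff_expXi_mem_wtIdeal γ q.1) h1)
        (by omega)
    · rfl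
  trans ∑ q ∈ T, g q
  · change ∑ᶠ q, g q = _
    refine finsum_eq_sum_of_support_subset _ fun q hq => ?_
    by_contra h
    rcases lt_or_ge q.1 K with hlt | hge
    · refine hq (if_neg fun he => h ?_)
      rw [hT, coe_image]
      exact ⟨q.1, by simpa using hlt, Prod.ext rfl (by dsimp only; omega)⟩
    · exact hq (h0 q hge)
  · rw [sum_image fun _ _ _ _ h => congrArg Prod.fst h]
    refine sum_congr rfl fun k _ => ?_
    rw [hg]
    dsimp only
    rcases lt_or_ge (n + 1 + k) 0 with h | h
    · rw [zcoeff_of_neg h, mul_zero, map_zero, if_neg (by omega)]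
    · rw [zcoeff_of_nonneg h, if_pos (by omega)]

theorem residue_add (γ : Fin N) (n : ℤ) (p q : PowerSeries (Ser₂ N)) :
    residue n (expXi γ) (p + q) = residue n (expXi γ) p + residue n (expXi γ) q := by
  ext d
  rw [map_add]
  have hK := Nat.lt_succ_self (Finsupp.weight wt d)
  simp only [coeff_residue γ n _ d _ hK, map_add, mul_add, sum_add_distrib]

theorem residue_smul (γ : Fin N) (n : ℤ) (c : ℂ) (p : PowerSeries (Ser₂ N)) :
    residue n (expXi γ) (c • p) = c • residue n (expXi γ) p := by
  ext d
  have hz : ∀ m : ℤ, zcoeff m (c • p) = c • zcoeff m p := fun m => by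
    rcases lt_or_ge m 0 with h | h
    · rw [zcoeff_of_neg h, zcoeff_of_neg h, smul_zero]
    · rw [zcoeff_of_nonneg h, zcoeff_of_nonneg h, PowerSeries.coeff_smul]
  have hs : ∀ f : Ser₂ N, MvPowerSeries.coeff d (c • f) = c • MvPowerSeries.coeff d f :=
    fun f => MvPowerSeries.coeff_smul f d c
  have hK := Nat.lt_succ_self (Finsupp.weight wt d)
  simp only [hs, coeff_residue γ n _ d _ hK, hz, mul_smul_comm, smul_sum]

/-- Differentiating a residue: the derivative of the exponential factor multiplies it by `c z^j`. -/
theorem pderiv_residue {γ : Fin N} {i : TimeIdx N ⊕ TimeIdx N} {c : ℂ} {j : ℕ}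
    (hd : coeffDer (MvPowerSeries.pderiv ℂ i) (xi γ) = c • PowerSeries.X ^ j) (n : ℤ)
    (p : PowerSeries (Ser₂ N)) :
    MvPowerSeries.pderiv ℂ i (residue n (expXi γ) p) = residue (n + j) (expXi γ)
      (PowerSeries.X ^ j * coeffDer (MvPowerSeries.pderiv ℂ i) p + c • p) := by
  set d := MvPowerSeries.pderiv ℂ i with hddef
  have hexp := coeffDer_expXi hd
  ext e
  obtain ⟨K, hK, hK'⟩ : ∃ K, Finsupp.weight wt e < K ∧
      Finsupp.weight wt (e + Finsupp.single i 1) < K :=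
    ⟨max _ _ + 1, Nat.lt_succ_of_le (le_max_left _ _), Nat.lt_succ_of_le (le_max_right _ _)⟩
  rw [residue_add, residue_smul, map_add, MvPowerSeries.coeff_smul,
    coeff_residue γ (n + j) _ e (j + K) (by omega), coeff_residue γ (n + j) _ e K hK, hddef,
    MvPowerSeries.coeff_pderiv, coeff_residue γ n p _ (j + K) (by omega), sum_mul]
  simp only [← MvPowerSeries.coeff_pderiv, ← hddef, d.leibniz, smul_eq_mul, map_add,
    sum_add_distrib]
  congr 1
  · refine sum_congr rfl fun k _ => ?_
    rw [← zcoeff_coeffDer, ← zcoeff_X_pow_mul (n + 1 + k) j,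
      show n + 1 + k + (j : ℤ) = n + j + 1 + k by ring]
  · have h1 : ∀ k, d (PowerSeries.coeff k (expXi γ)) =
        c • (if j ≤ k then PowerSeries.coeff (k - j) (expXi γ) else 0) := fun k => by
      rw [← coeff_coeffDer, hexp, PowerSeries.coeff_smul, PowerSeries.coeff_X_pow_mul']
    simp only [h1]
    rw [sum_range_add, sum_eq_zero, zero_add, mul_sum]
    · refine sum_congr rfl fun k _ => ?_
      rw [if_pos (Nat.le_add_right j k), Nat.add_sub_cancel_left, mul_smul_comm,
        MvPowerSeries.coeff_smul, mul_comm (zcoeff _ _), Nat.cast_add,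
        show n + 1 + ((j : ℤ) + k) = n + j + 1 + k by ring]
    · intro k hk
      rw [mem_range] at hk
      rw [if_neg (by omega), smul_zero, mul_zero, map_zero]

/-- The fibres of the codiagonal of the index set of the times have at most two elements. -/
instance tendstoCofinite_codiagonal :
    Filter.TendstoCofinite (Sum.elim id id : TimeIdx N ⊕ TimeIdx N → TimeIdx N) :=
  (Filter.tendstoCofinite_iff_finite_preimage_singleton _).2 fun b =>
    (Set.toFinite {Sum.inl b, Sum.inr b}).subset fun x hx => by
      rcases x with x | x <;> simp_all

/-- The restriction of a series in `t` and `t'` to `t' = t`. -/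
noncomputable def restrict (N : ℕ) : Ser₂ N →+* Ser N :=
  (MvPowerSeries.rename (Sum.elim id id)).toRingHom

theorem restrict_apply (f : Ser₂ N) : restrict N f = MvPowerSeries.rename (Sum.elim id id) f := rfl

/-- For `t' = t` the exponential factor is `1`. -/
theorem restrict_coeff_expXi (γ : Fin N) (k : ℕ) :
    restrict N (PowerSeries.coeff k (expXi γ)) = if k = 0 then 1 else 0 := by
  have hxi : PowerSeries.map (restrict N) (xi γ) = 0 := by
    ext1 j
    rw [PowerSeries.coeff_map, map_zero, xi, PowerSeries.coeff_mk]
    split_ifs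
    · rw [map_sub, restrict_apply, restrict_apply, MvPowerSeries.rename_X, MvPowerSeries.rename_X]
      exact sub_self _
    · exact map_zero _
  have hs : ∀ (c : ℂ) (f : Ser₂ N), restrict N (c • f) = c • restrict N f :=
    fun c f => map_smul (MvPowerSeries.rename (R := ℂ) (Sum.elim id id)) c f
  rw [coeff_expXi γ k k le_rfl, map_sum, sum_range_succ']
  simp only [hs, ← PowerSeries.coeff_map, map_pow, hxi]
  rw [sum_eq_zero fun m _ => by rw [zero_pow (Nat.succ_ne_zero m), map_zero, smul_zero], zero_add,
    pow_zero, PowerSeries.coeff_one]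
  simp

theorem restrict_residue (γ : Fin N) (n : ℤ) (p : PowerSeries (Ser₂ N)) :
    restrict N (residue n (expXi γ) p) = zcoeff (n + 1) (PowerSeries.map (restrict N) p) := by
  ext d
  set T := (Filter.TendstoCofinite.finite_preimage_singleton
    (Finsupp.mapDomain (Sum.elim id id : TimeIdx N ⊕ TimeIdx N → TimeIdx N)) d).toFinset with hT
  have hcoeff : ∀ f : Ser₂ N, MvPowerSeries.coeff d (restrict N f) =
      ∑ e ∈ T, MvPowerSeries.coeff e f := fun f => MvPowerSeries.coeff_rename _ f d
  obtain ⟨K, hK⟩ : ∃ K, ∀ e ∈ T, Finsupp.weight wt e < K + 1 :=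
    ⟨T.sup fun e => Finsupp.weight wt e, fun e he =>
      Nat.lt_succ_of_le (le_sup (f := fun e => Finsupp.weight wt e) he)⟩
  rw [hcoeff, sum_congr rfl fun e he => coeff_residue γ n p e (K + 1) (hK e he), sum_comm]
  simp only [← hcoeff, map_mul, restrict_coeff_expXi]
  rw [sum_range_succ', sum_eq_zero, zero_add, if_pos rfl, one_mul, zcoeff_map, Nat.cast_zero,
    add_zero]
  intro k _
  rw [if_neg (Nat.succ_ne_zero k), zero_mul, map_zero]

/-! ### The bilinear identities on the diagonal -/

/-- A power series in `z⁻¹` with coefficients depending on `t`, as one depending on `t, t'`. -/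
noncomputable abbrev left : PowerSeries (Ser N) →+* PowerSeries (Ser₂ N) :=
  PowerSeries.map (MvPowerSeries.rename Sum.inl).toRingHom

/-- The same power series in `z⁻¹`, with `t` replaced by `t'`. -/
noncomputable abbrev right : PowerSeries (Ser N) →+* PowerSeries (Ser₂ N) :=
  PowerSeries.map (MvPowerSeries.rename Sum.inr).toRingHom

theorem map_restrict_left (F : PowerSeries (Ser N)) :
    PowerSeries.map (restrict N) (left F) = F := by
  ext1 k
  rw [PowerSeries.coeff_map, PowerSeries.coeff_map]
  change MvPowerSeries.rename _ (MvPowerSeries.rename _ _) = _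
  rw [MvPowerSeries.rename_rename]
  exact MvPowerSeries.rename_id_apply _

theorem map_restrict_right (F : PowerSeries (Ser N)) :
    PowerSeries.map (restrict N) (right F) = F := by
  ext1 k
  rw [PowerSeries.coeff_map, PowerSeries.coeff_map]
  change MvPowerSeries.rename _ (MvPowerSeries.rename _ _) = _
  rw [MvPowerSeries.rename_rename]
  exact MvPowerSeries.rename_id_apply _

theorem coeffDer_inl_left (i : TimeIdx N) (F : PowerSeries (Ser N)) :
    coeffDer (MvPowerSeries.pderiv ℂ (Sum.inl i)) (left F) =
      left (coeffDer (MvPowerSeries.pderiv ℂ i) F) := by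
  ext1 k
  rw [coeff_coeffDer, PowerSeries.coeff_map, PowerSeries.coeff_map, coeff_coeffDer]
  exact pderiv_rename Sum.inl Sum.inl_injective i _

theorem coeffDer_inr_right (i : TimeIdx N) (G : PowerSeries (Ser N)) :
    coeffDer (MvPowerSeries.pderiv ℂ (Sum.inr i)) (right G) =
      right (coeffDer (MvPowerSeries.pderiv ℂ i) G) := by
  ext1 k
  rw [coeff_coeffDer, PowerSeries.coeff_map, PowerSeries.coeff_map, coeff_coeffDer]
  exact pderiv_rename Sum.inr Sum.inr_injective i _

theorem coeffDer_inr_left (i : TimeIdx N) (F : PowerSeries (Ser N)) :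
    coeffDer (MvPowerSeries.pderiv ℂ (Sum.inr i)) (left F) = 0 := by
  ext1 k
  rw [coeff_coeffDer, PowerSeries.coeff_map, map_zero]
  exact pderiv_rename_of_notMem_range Sum.inl Sum.inl_injective (by simp) _

theorem coeffDer_inl_right (i : TimeIdx N) (G : PowerSeries (Ser N)) :
    coeffDer (MvPowerSeries.pderiv ℂ (Sum.inl i)) (right G) = 0 := by
  ext1 k
  rw [coeff_coeffDer, PowerSeries.coeff_map, map_zero]
  exact pderiv_rename_of_notMem_range Sum.inr Sum.inr_injective (by simp) _

theorem coeffDer_inl_xi (γ κ : Fin N) (j : ℕ+) :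
    coeffDer (MvPowerSeries.pderiv ℂ (Sum.inl (κ, j))) (xi γ) =
      (if κ = γ then (1 : ℂ) else 0) • PowerSeries.X ^ (j : ℕ) := by
  classical
  ext1 k
  rw [coeff_coeffDer, PowerSeries.coeff_smul, PowerSeries.coeff_X_pow]
  rcases Nat.eq_zero_or_pos k with rfl | hk
  · rw [PowerSeries.coeff_zero_eq_constantCoeff_apply, constantCoeff_xi, map_zero,
      if_neg j.pos.ne, smul_zero]
  · lift k to ℕ+ using hk
    rw [coeff_xi, map_sub, MvPowerSeries.pderiv_X, MvPowerSeries.pderiv_X]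
    by_cases h1 : κ = γ <;> by_cases h2 : j = k <;>
      simp [@eq_comm _ γ κ, @eq_comm _ k j, h1, h2]

theorem coeffDer_inr_xi (γ κ : Fin N) (j : ℕ+) :
    coeffDer (MvPowerSeries.pderiv ℂ (Sum.inr (κ, j))) (xi γ) =
      (-if κ = γ then (1 : ℂ) else 0) • PowerSeries.X ^ (j : ℕ) := by
  classical
  ext1 k
  rw [coeff_coeffDer, PowerSeries.coeff_smul, PowerSeries.coeff_X_pow]
  rcases Nat.eq_zero_or_pos k with rfl | hk
  · rw [PowerSeries.coeff_zero_eq_constantCoeff_apply, constantCoeff_xi, map_zero,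
      if_neg j.pos.ne, smul_zero]
  · lift k to ℕ+ using hk
    rw [coeff_xi, map_sub, MvPowerSeries.pderiv_X, MvPowerSeries.pderiv_X]
    by_cases h1 : κ = γ <;> by_cases h2 : j = k <;>
      simp [@eq_comm _ γ κ, @eq_comm _ k j, h1, h2]

/-- The derivation `∂ = ∑_κ ∂/∂t_{κ 1}` of the power series in the times. -/
noncomputable abbrev delSer (N : ℕ) : Derivation ℂ (Ser N) (Ser N) :=
  ∑ κ : Fin N, MvPowerSeries.pderiv ℂ ((κ, 1) : TimeIdx N)

/-- The operator `z - ∂ = -e^{ξ(t_γ, z)} ∂ e^{-ξ(t_γ, z)}` in terms of series in `z⁻¹`: it maps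
`z^n G(z⁻¹)` to `z^{n+1} (stepRight G)(z⁻¹)`. -/
noncomputable def stepRight (G : PowerSeries (Ser N)) : PowerSeries (Ser N) :=
  G - PowerSeries.X * coeffDer (delSer N) G

theorem sum_derivation_apply {ι S : Type*} [CommRing S] [Algebra ℂ S] (s : Finset ι)
    (d : ι → Derivation ℂ S S) (f : S) : (∑ i ∈ s, d i) f = ∑ i ∈ s, d i f := by
  induction s using Finset.cons_induction with
  | empty => rfl
  | cons i s hi ih => rw [sum_cons, sum_cons, Derivation.add_apply, ih]

theorem coeffDer_delSer (G : PowerSeries (Ser N)) : coeffDer (delSer N) G =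
    ∑ κ : Fin N, coeffDer (MvPowerSeries.pderiv ℂ ((κ, 1) : TimeIdx N)) G := by
  ext1 k
  rw [coeff_coeffDer, sum_derivation_apply, map_sum]
  exact sum_congr rfl fun κ _ => (coeff_coeffDer _ _ _).symm

theorem residue_sum {ι : Type*} (γ : Fin N) (n : ℤ) (s : Finset ι)
    (p : ι → PowerSeries (Ser₂ N)) :
    residue n (expXi γ) (∑ i ∈ s, p i) = ∑ i ∈ s, residue n (expXi γ) (p i) := by
  induction s using Finset.cons_induction with
  | empty => simpa using residue_smul γ n 0 0
  | cons i s hi ih => rw [sum_cons, sum_cons, residue_add, ih]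

/-- The derivation `-∑_κ ∂/∂t'_{κ 1}`, applied to a residue. -/
theorem sum_pderiv_residue (γ : Fin N) (n : ℤ) (F G : PowerSeries (Ser N)) :
    -∑ κ : Fin N, MvPowerSeries.pderiv ℂ (Sum.inr (κ, 1))
        (residue n (expXi γ) (left F * right G)) =
      residue (n + 1) (expXi γ) (left F * right (stepRight G)) := by
  have h1 : ∀ κ : Fin N, MvPowerSeries.pderiv ℂ (Sum.inr (κ, 1))
      (residue n (expXi γ) (left F * right G)) = residue (n + 1) (expXi γ)
        (left F * right (PowerSeries.X * coeffDer (MvPowerSeries.pderiv ℂ (κ, 1)) G) +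
          (-if κ = γ then (1 : ℂ) else 0) • (left F * right G)) := by
    intro κ
    rw [pderiv_residue (coeffDer_inr_xi γ κ 1), Derivation.leibniz, coeffDer_inr_left,
      coeffDer_inr_right, smul_zero, add_zero, smul_eq_mul, map_mul, PowerSeries.map_X]
    simp only [PNat.one_coe, pow_one, Nat.cast_one]
    rw [mul_left_comm]
  have h2 : ∑ κ : Fin N, (-if κ = γ then (1 : ℂ) else 0) • (left F * right G) =
      -(left F * right G) := by
    rw [sum_eq_single γ]
    · rw [if_pos rfl, neg_smul, one_smul]
    · intro κ _ hκ
      rw [if_neg hκ, neg_zero, zero_smul]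
    · intro h
      exact absurd (mem_univ γ) h
  have hneg : ∀ p, -residue (n + 1) (expXi γ) p = residue (n + 1) (expXi γ) (-p) := fun p => by
    have := residue_smul γ (n + 1) (-1) p
    rwa [neg_smul, one_smul, neg_smul, one_smul, eq_comm] at this
  rw [sum_congr rfl fun κ _ => h1 κ, ← residue_sum, hneg, sum_add_distrib, h2, ← mul_sum,
    ← map_sum, ← mul_sum, ← coeffDer_delSer, stepRight, map_sub]
  congr 1
  ring

theorem pderiv_inl_residue (γ κ : Fin N) (j : ℕ+) (n : ℤ) (F G : PowerSeries (Ser N)) :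
    MvPowerSeries.pderiv ℂ (Sum.inl (κ, j)) (residue n (expXi γ) (left F * right G)) =
      residue (n + j) (expXi γ) (left (PowerSeries.X ^ (j : ℕ) *
        coeffDer (MvPowerSeries.pderiv ℂ (κ, j)) F + (if κ = γ then (1 : ℂ) else 0) • F) *
          right G) := by
  rw [pderiv_residue (coeffDer_inl_xi γ κ j), Derivation.leibniz, coeffDer_inl_right,
    coeffDer_inl_left, smul_zero, zero_add, smul_eq_mul, map_add, map_mul, map_pow,
    PowerSeries.map_X]
  congr 1
  split_ifs
  · rw [one_smul, one_smul]
    ring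
  · rw [zero_smul, zero_smul, map_zero]
    ring

/-- Consequence on the diagonal `t' = t` of a bilinear identity, after `l` derivations in `t'`. -/
theorem sum_zcoeff_eq_zero {c n : Fin N → ℤ} {F G : Fin N → PowerSeries (Ser N)}
    (h : ∑ γ, c γ • residue (n γ) (expXi γ) (left (F γ) * right (G γ)) = 0) (l : ℕ) :
    ∑ γ, c γ • zcoeff (n γ + l + 1) (F γ * stepRight^[l] (G γ)) = 0 := by
  have key : ∑ γ, c γ • residue (n γ + l) (expXi γ)
      (left (F γ) * right (stepRight^[l] (G γ))) = 0 := by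
    induction l with
    | zero => simpa using h
    | succ l ih =>
      have h1 := congrArg (fun f => -∑ κ : Fin N, MvPowerSeries.pderiv ℂ (Sum.inr (κ, 1)) f) ih
      simp only [map_sum, map_zsmul, map_zero, sum_const_zero, neg_zero] at h1
      rw [sum_comm, ← sum_neg_distrib] at h1
      rw [← h1]
      refine sum_congr rfl fun γ _ => ?_
      rw [← smul_sum, ← smul_neg, sum_pderiv_residue, Function.iterate_succ_apply', Nat.cast_succ,
        add_assoc]
  have h2 := congrArg (restrict N) key
  rw [map_sum, map_zero] at h2
  rw [← h2]
  refine sum_congr rfl fun γ _ => ?_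
  rw [map_zsmul, restrict_residue, map_mul (PowerSeries.map _), map_restrict_left,
    map_restrict_right]

/-- The same consequence after a further derivation with respect to `t_{κ j}`. -/
theorem sum_zcoeff_pderiv_eq_zero {c n : Fin N → ℤ} {F G : Fin N → PowerSeries (Ser N)}
    (h : ∑ γ, c γ • residue (n γ) (expXi γ) (left (F γ) * right (G γ)) = 0) (κ : Fin N) (j : ℕ+)
    (l : ℕ) :
    ∑ γ, c γ • zcoeff (n γ + j + l + 1) ((PowerSeries.X ^ (j : ℕ) *
      coeffDer (MvPowerSeries.pderiv ℂ (κ, j)) (F γ) + (if κ = γ then (1 : ℂ) else 0) • F γ) *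
        stepRight^[l] (G γ)) = 0 := by
  refine sum_zcoeff_eq_zero (n := fun γ => n γ + j) ?_ l
  have h1 := congrArg (MvPowerSeries.pderiv ℂ (Sum.inl (κ, j))) h
  simpa only [map_sum, map_zsmul, map_zero, pderiv_inl_residue] using h1

end Residues

/-! ### The first two coefficients of a shifted series -/

section Shift
variable {N : ℕ}

/-- Substitution of the shifted times, as a homomorphism. -/
noncomputable def shiftHom (c : ℂ) (γ : Fin N) : Ser N →ₐ[ℂ] PowerSeries (Ser N) :=
  (MvPowerSeries.optionEquivLeft (TimeIdx N) ℂ).toAlgHom.comp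
    (MvPowerSeries.substAlgHom (hasSubst_shiftFamily c γ))

theorem shiftHom_apply (c : ℂ) (γ : Fin N) (f : Ser N) : shiftHom c γ f = shift c γ f := by
  rw [shift, ← MvPowerSeries.coe_substAlgHom (hasSubst_shiftFamily c γ)]
  rfl

theorem shift_X (c : ℂ) (γ : Fin N) (p : TimeIdx N) :
    shift c γ (MvPowerSeries.X p) = PowerSeries.C (MvPowerSeries.X p) +
      if p.1 = γ then PowerSeries.C (MvPowerSeries.C (c / (p.2 : ℕ))) * PowerSeries.X ^ (p.2 : ℕ)
      else 0 := by
  rw [shift, MvPowerSeries.subst_X (hasSubst_shiftFamily c γ), shiftFamily, map_add,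
    MvPowerSeries.optionEquivLeft_X_some]
  split_ifs
  · rw [map_mul, map_pow, MvPowerSeries.optionEquivLeft_X_none, MvPowerSeries.optionEquivLeft_C]
  · rw [map_zero]

theorem coeff_zero_shift_X (c : ℂ) (γ : Fin N) (p : TimeIdx N) :
    PowerSeries.coeff 0 (shift c γ (MvPowerSeries.X p)) = MvPowerSeries.X p := by
  rw [shift_X]
  split_ifs <;> simp

theorem coeff_one_shift_X (c : ℂ) (γ : Fin N) (p : TimeIdx N) :
    PowerSeries.coeff 1 (shift c γ (MvPowerSeries.X p)) =
      c • MvPowerSeries.pderiv ℂ (γ, 1) (MvPowerSeries.X p) := by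
  classical
  rw [shift_X, MvPowerSeries.pderiv_X]
  obtain ⟨κ, j⟩ := p
  by_cases h1 : κ = γ
  · by_cases h2 : j = 1
    · subst h1 h2
      simp [MvPowerSeries.smul_eq_C_mul]
    · have h3 : (1 : ℕ) ≠ j := fun h => h2 (PNat.coe_eq_one_iff.1 h.symm)
      simp [h1, h2, PowerSeries.coeff_X_pow, h3]
  · simp [h1]

theorem coeff_shift_coe (c : ℂ) (γ : Fin N) (q : MvPolynomial (TimeIdx N) ℂ) :
    PowerSeries.coeff 0 (shift c γ (q : Ser N)) = q ∧
      PowerSeries.coeff 1 (shift c γ (q : Ser N)) =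
        c • MvPowerSeries.pderiv ℂ (γ, 1) (q : Ser N) := by
  simp only [← shiftHom_apply]
  induction q using MvPolynomial.induction_on with
  | C a =>
    have h : ((MvPolynomial.C a : MvPolynomial (TimeIdx N) ℂ) : Ser N) =
        algebraMap ℂ (Ser N) a := by
      rw [MvPolynomial.coe_C]
      rfl
    rw [h, AlgHom.commutes, Derivation.map_algebraMap, smul_zero, PowerSeries.algebraMap_apply]
    exact ⟨by simp, by simp⟩
  | add p q hp hq =>
    rw [MvPolynomial.coe_add, map_add, map_add, map_add, map_add, hp.1, hq.1, hp.2, hq.2, smul_add]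
    exact ⟨rfl, rfl⟩
  | mul_X p i hp =>
    have h0 := coeff_zero_shift_X c γ i
    have h1 := coeff_one_shift_X c γ i
    rw [← shiftHom_apply, PowerSeries.coeff_zero_eq_constantCoeff_apply] at h0
    rw [← shiftHom_apply] at h1
    obtain ⟨hp0, hp1⟩ := hp
    rw [PowerSeries.coeff_zero_eq_constantCoeff_apply] at hp0
    rw [MvPolynomial.coe_mul, MvPolynomial.coe_X, map_mul, PowerSeries.coeff_one_mul, hp1, h1,
      PowerSeries.coeff_zero_eq_constantCoeff_apply, map_mul, hp0, h0, Derivation.leibniz]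
    refine ⟨rfl, ?_⟩
    rw [smul_eq_mul, smul_eq_mul, smul_add, smul_mul_assoc, smul_mul_assoc, add_comm,
      mul_comm (MvPowerSeries.X i), mul_comm (p : Ser N)]

/-- The coefficients of a shifted series are determined by the shifts of the monomials. -/
theorem coeff_coeff_shift (c : ℂ) (γ : Fin N) (f : Ser N) (n : ℕ) (x : TimeIdx N →₀ ℕ) :
    MvPowerSeries.coeff x (PowerSeries.coeff n (shift c γ f)) =
      ∑ᶠ d, MvPowerSeries.coeff d f * MvPowerSeries.coeff x (PowerSeries.coeff n
        (shift c γ (MvPowerSeries.monomial d 1))) := by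
  simp only [shift, MvPowerSeries.coeff_coeff_optionEquivLeft,
    MvPowerSeries.coeff_subst (hasSubst_shiftFamily c γ) f, smul_eq_mul,
    MvPowerSeries.subst_monomial (hasSubst_shiftFamily c γ), map_one, one_mul]

theorem coeff_zero_shift (c : ℂ) (γ : Fin N) (f : Ser N) :
    PowerSeries.coeff 0 (shift c γ f) = f := by
  classical
  ext x
  rw [coeff_coeff_shift, finsum_eq_single _ x]
  · rw [← MvPolynomial.coe_monomial, (coeff_shift_coe c γ _).1, MvPolynomial.coe_monomial,
      MvPowerSeries.coeff_monomial_same, mul_one]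
  · intro d hd
    rw [← MvPolynomial.coe_monomial, (coeff_shift_coe c γ _).1, MvPolynomial.coe_monomial,
      MvPowerSeries.coeff_monomial_ne hd.symm, mul_zero]

theorem coeff_one_shift (c : ℂ) (γ : Fin N) (f : Ser N) :
    PowerSeries.coeff 1 (shift c γ f) = c • MvPowerSeries.pderiv ℂ (γ, 1) f := by
  classical
  ext x
  have h : ∀ d, MvPowerSeries.coeff x (PowerSeries.coeff 1
      (shift c γ (MvPowerSeries.monomial d 1))) =
        c * (MvPowerSeries.coeff (x + Finsupp.single (γ, 1) 1) (MvPowerSeries.monomial d (1 : ℂ)) *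
          (x (γ, 1) + 1)) := by
    intro d
    rw [← MvPolynomial.coe_monomial, (coeff_shift_coe c γ _).2, MvPowerSeries.coeff_smul,
      MvPowerSeries.coeff_pderiv]
  rw [coeff_coeff_shift, finsum_eq_single _ (x + Finsupp.single (γ, 1) 1)]
  · rw [h, MvPowerSeries.coeff_monomial_same, one_mul, MvPowerSeries.coeff_smul,
      MvPowerSeries.coeff_pderiv, mul_left_comm]
  · intro d hd
    rw [h, MvPowerSeries.coeff_monomial_ne hd.symm, zero_mul, mul_zero, mul_zero]

end Shift

/-! ### Commuting derivations -/

section Commute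

theorem pderiv_comm {σ : Type*} (i j : σ) (f : MvPowerSeries σ ℂ) :
    MvPowerSeries.pderiv ℂ i (MvPowerSeries.pderiv ℂ j f) =
      MvPowerSeries.pderiv ℂ j (MvPowerSeries.pderiv ℂ i f) := by
  by_cases h : i = j
  · rw [h]
  ext n
  simp only [MvPowerSeries.coeff_pderiv, Finsupp.add_apply, Finsupp.single_eq_of_ne h,
    Finsupp.single_eq_of_ne (Ne.symm h), add_zero]
  rw [add_right_comm, mul_right_comm]

/-- Derivations of a field of fractions that commute on the ring commute. -/
theorem fracDer_comm {A : Type*} [CommRing A] [IsDomain A] [Algebra ℂ A] {d d' : Derivation ℂ A A}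
    (h : ∀ a, d (d' a) = d' (d a)) (x : FractionRing A) :
    fracDer d (fracDer d' x) = fracDer d' (fracDer d x) := by
  obtain ⟨a, b, hb, rfl⟩ := IsFractionRing.div_surjective (A := A) x
  have hb' : algebraMap A (FractionRing A) b ≠ 0 :=
    IsFractionRing.to_map_ne_zero_of_mem_nonZeroDivisors hb
  set y := algebraMap A (FractionRing A) a / algebraMap A (FractionRing A) b with hy
  have hyb : y * algebraMap A _ b = algebraMap A _ a := div_mul_cancel₀ _ hb'
  have h1 := congrArg (fun z => fracDer d (fracDer d' z) - fracDer d' (fracDer d z)) hyb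
  simp only [AddDer.leibniz', map_add, fracDer_algebraMap, h, sub_self] at h1
  have h2 : (fracDer d (fracDer d' y) - fracDer d' (fracDer d y)) * algebraMap A _ b = 0 := by
    rw [← h1]
    ring
  exact sub_eq_zero.1 ((mul_eq_zero.1 h2).resolve_right hb')

theorem dt_del_comm {N : ℕ} (p : TimeIdx N) (x : Fld N) : dt p (del N x) = del N (dt p x) := by
  refine fracDer_comm (fun a => ?_) x
  rw [sum_derivation_apply, sum_derivation_apply, map_sum]
  exact sum_congr rfl fun κ _ => pderiv_comm _ _ _

end Commute

section Matrices
variable {N : ℕ}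

/-! ### Constant diagonal operators -/

theorem matrix_apply {A : Type*} [Ring A] (d : AddDer A) (X : Matrix (Fin N) (Fin N) A)
    (i j : Fin N) : d.matrix N X i j = d (X i j) := rfl

theorem der_E (d : AddDer (Fld N)) (α : Fin N) : d.matrix N (E α) = 0 := by
  ext i j
  rw [matrix_apply, E, Matrix.single_apply]
  split_ifs
  · exact d.map_one
  · exact map_zero d.toHom

theorem E_apply (α i j : Fin N) : (E α : Mat N) i j = if α = i ∧ α = j then 1 else 0 :=
  Matrix.single_apply ..

theorem mul_E_apply (M : Mat N) (α i j : Fin N) : (M * E α) i j = if α = j then M i j else 0 := by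
  rw [Matrix.mul_apply, sum_eq_single α]
  · rw [E_apply]
    by_cases h : α = j
    · subst h; simp
    · simp [h]
  · intro k _ hk
    rw [E_apply, if_neg fun h => hk h.1.symm, mul_zero]
  · intro h
    exact absurd (mem_univ α) h

theorem E_mul_E (α β : Fin N) : (E α * E β : Mat N) = if α = β then E α else 0 := by
  ext i j
  rw [mul_E_apply, E_apply]
  by_cases h : α = β
  · subst h
    rw [if_pos rfl, E_apply]
    split_ifs <;> grind
  · rw [if_neg h, Matrix.zero_apply]
    split_ifs <;> grind

theorem sum_E : ∑ α : Fin N, E α = (1 : Mat N) := by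
  ext i j
  rw [Matrix.sum_apply, sum_eq_single i, E_apply, Matrix.one_apply]
  · simp
  · intro α _ hα
    rw [E_apply, if_neg fun h => hα h.1]
  · intro h
    exact absurd (mem_univ i) h

theorem coeff_sum {ι : Type*} (s : Finset ι) (a : ι → Op N) (n : ℤ) :
    (∑ i ∈ s, a i).coeff n = ∑ i ∈ s, (a i).coeff n := by
  induction s using Finset.cons_induction with
  | empty => rfl
  | cons i s hi ih => rw [sum_cons, sum_cons, PDO.coeff_add, ih]

/-- The operator `diag(∂^{d_1}, …, ∂^{d_N})`. -/
noncomputable def Lam (d : Fin N → ℤ) : Op N := ∑ β : Fin N, PDO.single (d β) (E β)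

theorem coeff_Lam_apply (d : Fin N → ℤ) (n : ℤ) (i j : Fin N) :
    (Lam d).coeff n i j = if n = d j ∧ i = j then 1 else 0 := by
  rw [Lam, coeff_sum, Matrix.sum_apply, sum_eq_single j]
  · rw [PDO.coeff_single]
    split_ifs with h1 h2 h2
    · rw [E_apply, if_pos ⟨h2.2.symm, rfl⟩]
    · rw [E_apply, if_neg fun h => h2 ⟨h1, h.1.symm⟩]
    · exact absurd h2.1 h1
    · rfl
  · intro β _ hβ
    rw [PDO.coeff_single]
    split_ifs
    · rw [E_apply, if_neg fun h => hβ h.2]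
    · rfl
  · intro h
    exact absurd (mem_univ j) h

theorem coeff_mul_Lam_apply (a : Op N) (d : Fin N → ℤ) (n : ℤ) (i j : Fin N) :
    (a * Lam d).coeff n i j = a.coeff (n - d j) i j := by
  rw [Lam, mul_sum, coeff_sum, Matrix.sum_apply, sum_eq_single j]
  · rw [PDO.coeff_mul_single _ (der_E _ j), mul_E_apply, if_pos rfl]
  · intro β _ hβ
    rw [PDO.coeff_mul_single _ (der_E _ β), mul_E_apply, if_neg hβ]
  · intro h
    exact absurd (mem_univ j) h

theorem Lam_mul_Lam (d d' : Fin N → ℤ) : (Lam d * Lam d' : Op N) = Lam (d + d') := by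
  ext n i j
  rw [coeff_mul_Lam_apply, coeff_Lam_apply, coeff_Lam_apply, Pi.add_apply]
  exact if_congr (and_congr_left fun _ => by omega) rfl rfl

theorem Lam_zero : (Lam 0 : Op N) = 1 := by
  ext n i j
  rw [coeff_Lam_apply, PDO.coeff_one]
  by_cases hn : n = 0
  · rw [if_pos hn, Matrix.one_apply]
    exact if_congr (and_iff_right hn) rfl rfl
  · rw [if_neg hn, if_neg fun h => hn h.1, Matrix.zero_apply]

theorem Lam_mul_single (d : Fin N → ℤ) (m : ℤ) (α : Fin N) :
    (Lam d * PDO.single m (E α) : Op N) = PDO.single (d α + m) (E α) := by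
  rw [Lam, sum_mul, sum_eq_single α]
  · rw [PDO.single_mul_single _ (der_E _ α), E_mul_E, if_pos rfl]
  · intro β _ hβ
    rw [PDO.single_mul_single _ (der_E _ α), E_mul_E, if_neg hβ]
    ext n
    rw [PDO.coeff_single, ite_self]
    rfl
  · intro h
    exact absurd (mem_univ α) h

theorem single_mul_Lam (d : Fin N → ℤ) (m : ℤ) (α : Fin N) :
    (PDO.single m (E α) * Lam d : Op N) = PDO.single (d α + m) (E α) := by
  rw [Lam, mul_sum, sum_eq_single α]
  · rw [PDO.single_mul_single _ (der_E _ α), E_mul_E, if_pos rfl, add_comm]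
  · intro β _ hβ
    rw [PDO.single_mul_single _ (der_E _ β), E_mul_E, if_neg (Ne.symm hβ)]
    ext n
    rw [PDO.coeff_single, ite_self]
    rfl
  · intro h
    exact absurd (mem_univ α) h

theorem sum_single_E (m : ℤ) : ∑ α : Fin N, PDO.single m (E α) = (PDO.single m 1 : Op N) := by
  ext n
  rw [coeff_sum, PDO.coeff_single, ← sum_E]
  simp only [PDO.coeff_single]
  split_ifs
  · rfl
  · rw [sum_const_zero]

theorem Lam_mul_delOp (d : Fin N → ℤ) : (Lam d * delOp N : Op N) = delOp N * Lam d := by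
  rw [delOp, ← sum_single_E, mul_sum, sum_mul]
  exact sum_congr rfl fun α _ => by rw [Lam_mul_single, single_mul_Lam]

/-- The operator of multiplication by a scalar. -/
noncomputable def sc (y : Fld N) : Op N := PDO.single 0 (y • 1)

theorem sc_mul_sc (x y : Fld N) : (sc x * sc y : Op N) = sc (x * y) := by
  rw [sc, sc, sc, PDO.single_zero_mul_single, smul_mul_smul_comm, one_mul]

theorem sc_one : (sc 1 : Op N) = 1 := by
  rw [sc, one_smul]
  rfl

theorem coeff_sc_mul_apply (y : Fld N) (a : Op N) (n : ℤ) (i j : Fin N) :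
    (sc y * a).coeff n i j = y * a.coeff n i j := by
  rw [sc, PDO.coeff_single_zero_mul, smul_mul_assoc, one_mul, Matrix.smul_apply, smul_eq_mul]

/-! ### Derivatives with respect to the times -/

theorem opDt_mul (γ : Fin N) (j : ℕ+) (a b : Op N) :
    opDt γ j (a * b) = a * opDt γ j b + opDt γ j a * b :=
  PDO.mapCoeff_mul (D' := (dt (γ, j)).matrix N) (fun X => by
    ext i k
    exact dt_del_comm (γ, j) (X i k)) a b

theorem opDt_single_E (γ : Fin N) (j : ℕ+) (m : ℤ) (α : Fin N) :
    opDt γ j (PDO.single m (E α)) = 0 := by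
  rw [opDt, PDO.mapCoeff_single]
  have h : ((dt (γ, j)).matrix N).toHom (E α) = 0 := der_E _ α
  rw [h]
  ext n
  rw [PDO.coeff_single, ite_self]
  rfl

theorem opDt_Lam (γ : Fin N) (j : ℕ+) (d : Fin N → ℤ) : opDt γ j (Lam d) = 0 := by
  rw [opDt, Lam, PDO.mapCoeff_sum]
  exact sum_eq_zero fun α _ => opDt_single_E γ j _ α

theorem opDt_delOp (γ : Fin N) (j : ℕ+) : opDt γ j (delOp N) = 0 := by
  rw [opDt, delOp, ← sum_single_E, PDO.mapCoeff_sum]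
  exact sum_eq_zero fun α _ => opDt_single_E γ j _ α

theorem opDt_sc (γ : Fin N) (j : ℕ+) (y : Fld N) : opDt γ j (sc y) = sc (dt (γ, j) y) := by
  rw [opDt, sc, PDO.mapCoeff_single]
  congr 1
  ext i k
  change dt (γ, j) ((y • (1 : Mat N)) i k) = _
  rw [Matrix.smul_apply, Matrix.smul_apply, Matrix.one_apply]
  split_ifs
  · rw [smul_eq_mul, mul_one, smul_eq_mul, mul_one]
  · rw [smul_zero, smul_zero]
    exact map_zero _

end Matrices

/-! ### The wave operator and its inverse -/

section Wave
variable {N : ℕ}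

/-- The embedding of the power series in the times into their field of fractions. -/
noncomputable abbrev toFld : Ser N →+* Fld N := algebraMap (Ser N) (Fld N)

theorem del_toFld (f : Ser N) : del N (toFld f) = toFld (delSer N f) := fracDer_algebraMap _ f

theorem dt_toFld (p : TimeIdx N) (f : Ser N) :
    dt p (toFld f) = toFld (MvPowerSeries.pderiv ℂ p f) := fracDer_algebraMap _ f

/-- The symbol `∑_n a_n z^n` of the operator `a = ∑_n a_n ∂ⁿ` has the entries
`c_{ij} z^{m_{ij}} F_{ij}(z⁻¹)`. -/
def HasSymbol (a : Op N) (c m : Fin N → Fin N → ℤ) (F : Fin N → Fin N → PowerSeries (Ser N)) :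
    Prop :=
  ∀ n i j, a.coeff n i j = toFld (c i j • zcoeff (m i j - n) (F i j))

/-- The symbol of `b` with coefficients on the right changes by `z - ∂` when `∑_m ∂^m b_m` is
multiplied by `∂` from the right. -/
theorem HasSymbol.iterate_rightShift {b : Op N} {c m : Fin N → Fin N → ℤ}
    {G : Fin N → Fin N → PowerSeries (Ser N)} (hb : HasSymbol b c m G) (l : ℕ) :
    HasSymbol (PDO.rightShift^[l] b) c (fun i j => m i j + l)
      (fun i j => stepRight^[l] (G i j)) := by
  induction l with
  | zero => simpa using hb
  | succ l ih =>
    intro n i j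
    dsimp only
    rw [Function.iterate_succ_apply', Function.iterate_succ_apply']
    change (PDO.rightShift^[l] b).coeff (n - 1) i j -
      del N ((PDO.rightShift^[l] b).coeff n i j) = _
    rw [ih, ih, del_toFld, ← map_sub, map_zsmul, ← smul_sub, ← zcoeff_coeffDer, stepRight, map_sub,
      ← zcoeff_X_mul (m i j + l - n) (coeffDer (delSer N) (stepRight^[l] (G i j)))]
    push_cast
    rw [show m i j + (l + 1 : ℤ) - n = m i j + l - n + 1 by ring,
      show m i j + (l : ℤ) - (n - 1) = m i j + l - n + 1 by ring]

theorem eq_zero_of_toFld_zsmul {c : ℤ} (hc : c ≠ 0) {f : Ser N} (h : toFld (c • f) = 0) :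
    f = 0 := by
  have : CharZero (Ser N) := charZero_of_injective_algebraMap (algebraMap ℂ (Ser N)).injective
  have h1 := (map_eq_zero_iff _ (IsFractionRing.injective (Ser N) (Fld N))).1 h
  rw [zsmul_eq_mul] at h1
  exact (mul_eq_zero.1 h1).resolve_left (Int.cast_ne_zero.2 hc)

/-- The negative part of the product of the operators with left symbol `a` and right symbol `b` is
given by the residues of the product of the symbols. -/
theorem HasSymbol.isDiff_mul_ofRight {a b : Op N} {c m c' m' : Fin N → Fin N → ℤ}
    {F G : Fin N → Fin N → PowerSeries (Ser N)} (ha : HasSymbol a c m F) (hb : HasSymbol b c' m' G)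
    (h : ∀ (α β : Fin N) (l : ℕ), ∑ γ, (c α γ * c' γ β) •
      zcoeff (m α γ + m' γ β + l + 1) (F α γ * stepRight^[l] (G γ β)) = 0) :
    PDO.IsDiff (a * PDO.ofRight b) := by
  refine PDO.isDiff_mul_ofRight fun l => ?_
  obtain ⟨M, hM⟩ := a.bdd'
  obtain ⟨M', hM'⟩ := (PDO.rightShift^[l] b).bdd'
  have hb' := hb.iterate_rightShift l
  rw [PDO.coeff_mul_ofRight hM hM']
  ext α β
  rw [Matrix.sum_apply]
  simp only [Matrix.mul_apply]
  rw [sum_comm, Matrix.zero_apply, ← map_zero toFld, ← h α β l, map_sum]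
  refine sum_congr rfl fun γ _ => ?_
  -- the bounds `M`, `M'` say nothing about `F` and `G` at entries where a coefficient vanishes
  by_cases hc : c α γ * c' γ β = 0
  · rw [hc, zero_smul, map_zero]
    refine sum_eq_zero fun i _ => ?_
    rw [ha, hb', ← map_mul, smul_mul_smul_comm, hc, zero_smul, map_zero]
  have hc1 : c α γ ≠ 0 := left_ne_zero_of_mul hc
  have hc2 : c' γ β ≠ 0 := right_ne_zero_of_mul hc
  rw [show m α γ + m' γ β + (l : ℤ) + 1 = m α γ + (m' γ β + l) + 1 by ring,
    ← sum_zcoeff_mul_zcoeff (m α γ) (m' γ β + l) (F α γ) (stepRight^[l] (G γ β)) (-1 - M') M,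
    smul_sum, map_sum]
  · refine sum_congr rfl fun i _ => ?_
    rw [ha, hb', ← map_mul, smul_mul_smul_comm]
  · intro i hi
    have := congrFun (congrFun (hM' (-1 - i) (by omega)) γ) β
    rw [hb'] at this
    exact eq_zero_of_toFld_zsmul hc2 this
  · intro i hi
    have := congrFun (congrFun (hM i hi) α) γ
    rw [ha] at this
    exact eq_zero_of_toFld_zsmul hc1 this

end Wave

section Tau
variable {N : ℕ} {τ : Charge N → Ser N}

/-- The operator `τ(s) What(s)`, whose coefficients are power series. -/
noncomputable def Wt (τ : Charge N → Ser N) (s : Charge N) : Op N :=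
  ⟨fun n => Matrix.of fun α γ => toFld (eps α γ s •
      zcoeff (kd α γ - 1 - n) (shift (-1) γ (τ (s + root α γ)))), 0, fun n hn => by
    ext α γ
    rw [Matrix.of_apply, zcoeff_of_neg, smul_zero, map_zero, Matrix.zero_apply]
    unfold kd
    split_ifs <;> omega⟩

/-- The coefficients, to be written on the right, of `τ(s) What(s)⁻¹`; the entry
`(γ, β)` of their symbol is `ε_{βγ}(s) τ(s - e_β + e_γ, t + [z⁻¹]_γ) z^{δ_{βγ} - 1}`, the
adjoint wave function without `z^{-s_γ} e^{-ξ(t_γ, z)} / τ(s, t)`. -/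
noncomputable def Vsym (τ : Charge N → Ser N) (s : Charge N) : Op N :=
  ⟨fun n => Matrix.of fun γ β => toFld (eps β γ s •
      zcoeff (kd β γ - 1 - n) (shift 1 γ (τ (s - root β γ)))), 0, fun n hn => by
    ext γ β
    rw [Matrix.of_apply, zcoeff_of_neg, smul_zero, map_zero, Matrix.zero_apply]
    unfold kd
    split_ifs <;> omega⟩

/-- The operator `τ(s) What(s)⁻¹`. -/
noncomputable def Vt (τ : Charge N → Ser N) (s : Charge N) : Op N := PDO.ofRight (Vsym τ s)

theorem hasSymbol_Wt_mul_Lam (s : Charge N) (d : Fin N → ℤ) :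
    HasSymbol (Wt τ s * Lam d) (fun α γ => eps α γ s) (fun α γ => kd α γ - 1 + d γ)
      (fun α γ => shift (-1) γ (τ (s + root α γ))) := by
  intro n α γ
  rw [coeff_mul_Lam_apply]
  change toFld (eps α γ s • zcoeff (kd α γ - 1 - (n - d γ)) _) = _
  rw [show kd α γ - 1 - (n - d γ) = kd α γ - 1 + d γ - n by ring]

theorem hasSymbol_Vsym (s : Charge N) :
    HasSymbol (Vsym τ s) (fun γ β => eps β γ s) (fun γ β => kd β γ - 1)
      (fun γ β => shift 1 γ (τ (s - root β γ))) := fun _ _ _ => rfl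

/-- The symbol of `τ What diag(∂^d)`, multiplied by the exponential factor, differentiated by
`t_{κ j}` and divided by the exponential factor. A factor `z^j` is moved into the exponents. -/
theorem hasSymbol_derivative (s : Charge N) (d : Fin N → ℤ) (κ : Fin N) (j : ℕ+) :
    HasSymbol (opDt κ j (Wt τ s) * Lam d + Wt τ s * Lam d * PDO.single j (E κ))
      (fun α γ => eps α γ s) (fun α γ => kd α γ - 1 + d γ + j)
      (fun α γ => PowerSeries.X ^ (j : ℕ) * coeffDer (MvPowerSeries.pderiv ℂ (κ, j))
        (shift (-1) γ (τ (s + root α γ))) +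
          (if κ = γ then (1 : ℂ) else 0) • shift (-1) γ (τ (s + root α γ))) := by
  intro n α γ
  have h1 : opDt κ j (Wt τ s) * Lam d = opDt κ j (Wt τ s * Lam d) := by
    rw [opDt_mul, opDt_Lam, mul_zero, zero_add]
  rw [h1, PDO.coeff_add, Matrix.add_apply, PDO.coeff_mul_single _ (der_E _ κ), mul_E_apply]
  change dt (κ, j) ((Wt τ s * Lam d).coeff n α γ) + _ = _
  rw [hasSymbol_Wt_mul_Lam, hasSymbol_Wt_mul_Lam, dt_toFld, map_zsmul, ← zcoeff_coeffDer,
    ← zcoeff_X_pow_mul _ (j : ℕ), map_add, smul_add, map_add]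
  rw [show kd α γ - 1 + d γ - n + ((j : ℕ) : ℤ) = kd α γ - 1 + d γ + j - n by ring,
    show kd α γ - 1 + d γ - (n - ((j : ℕ) : ℤ)) = kd α γ - 1 + d γ + j - n by ring]
  congr 1
  split_ifs
  · rw [one_smul]
  · rw [zero_smul, map_zero, smul_zero, map_zero]

theorem IsTau.bilinear (hτ : IsTau τ) (s s' : Charge N) (α β : Fin N) :
    ∑ γ, (eps α γ s * eps β γ s') • residue (s.1 γ - s'.1 γ + kd α γ + kd β γ - 2) (expXi γ)
      (left (shift (-1) γ (τ (s + root α γ))) * right (shift 1 γ (τ (s' - root β γ)))) = 0 :=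
  hτ s s' α β

/-- The bilinear identities in operator form. -/
theorem IsTau.isDiff_mul (hτ : IsTau τ) (s s' : Charge N) :
    PDO.IsDiff (Wt τ s * Lam (s.1 - s'.1) * Vt τ s') := by
  refine (hasSymbol_Wt_mul_Lam s _).isDiff_mul_ofRight (hasSymbol_Vsym s') fun α β l => ?_
  rw [← sum_zcoeff_eq_zero (hτ.bilinear s s' α β) l]
  refine sum_congr rfl fun γ _ => ?_
  rw [Pi.sub_apply, show kd α γ - 1 + (s.1 γ - s'.1 γ) + (kd β γ - 1) =
    s.1 γ - s'.1 γ + kd α γ + kd β γ - 2 by ring]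

/-- The derivatives of the bilinear identities in operator form. -/
theorem IsTau.isDiff_derivative_mul (hτ : IsTau τ) (s s' : Charge N) (κ : Fin N) (j : ℕ+) :
    PDO.IsDiff ((opDt κ j (Wt τ s) * Lam (s.1 - s'.1) +
      Wt τ s * Lam (s.1 - s'.1) * PDO.single j (E κ)) * Vt τ s') := by
  refine (hasSymbol_derivative s _ κ j).isDiff_mul_ofRight (hasSymbol_Vsym s') fun α β l => ?_
  rw [← sum_zcoeff_pderiv_eq_zero (hτ.bilinear s s' α β) κ j l]
  refine sum_congr rfl fun γ _ => ?_
  rw [Pi.sub_apply, show kd α γ - 1 + (s.1 γ - s'.1 γ) + j + (kd β γ - 1) =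
    s.1 γ - s'.1 γ + kd α γ + kd β γ - 2 + j by ring]

/-! ### Leading coefficients -/

theorem eps_self (α : Fin N) (s : Charge N) : eps α α s = 1 := by
  rw [eps, if_neg (lt_irrefl α), if_pos rfl]

theorem kd_self (α : Fin N) : kd α α = 1 := if_pos rfl

theorem kd_of_ne {α β : Fin N} (h : α ≠ β) : kd α β = 0 := if_neg h

theorem root_self (α : Fin N) : root α α = 0 := Subtype.ext (sub_self _)

theorem toFld_ne_zero {f : Ser N} (hf : f ≠ 0) : toFld f ≠ 0 :=
  (map_ne_zero_iff _ (IsFractionRing.injective (Ser N) (Fld N))).2 hf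

theorem ordLE_Vsym (s : Charge N) : PDO.OrdLE (Vsym τ s) 0 := by
  intro n hn
  ext γ β
  change toFld _ = 0
  rw [zcoeff_of_neg, smul_zero, map_zero]
  unfold kd
  split_ifs <;> omega

theorem ordLE_Vt (s : Charge N) : PDO.OrdLE (Vt τ s) 0 := by
  intro n hn
  rw [Vt, PDO.coeff_ofRight (ordLE_Vsym s) n 0 (by simpa using hn), range_zero, sum_empty]

theorem coeff_zero_Wt (s : Charge N) : (Wt τ s).coeff 0 = toFld (τ s) • (1 : Mat N) := by
  ext α γ
  change toFld _ = _
  by_cases h : α = γ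
  · subst h
    rw [eps_self, one_smul, kd_self, zcoeff_of_nonneg (by simp), root_self, add_zero]
    simp [coeff_zero_shift]
  · rw [kd_of_ne h, zcoeff_of_neg (by simp), smul_zero, map_zero]
    simp [h]

theorem coeff_zero_Vt (s : Charge N) : (Vt τ s).coeff 0 = toFld (τ s) • (1 : Mat N) := by
  rw [Vt, PDO.coeff_ofRight (ordLE_Vsym s) 0 1 (by simp), sum_range_one]
  ext γ β
  simp only [Nat.cast_zero, add_zero, Ring.choose_zero_right, one_smul, Function.iterate_zero, id]
  change toFld _ = _
  by_cases h : β = γ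
  · subst h
    rw [eps_self, one_smul, kd_self, zcoeff_of_nonneg (by simp), root_self, sub_zero]
    simp [coeff_zero_shift]
  · rw [kd_of_ne h, zcoeff_of_neg (by simp), smul_zero, map_zero]
    simp [Ne.symm h]

theorem sc_mul_Wt (s : Charge N) : sc (toFld (τ s))⁻¹ * Wt τ s = What τ s := by
  ext n α γ
  rw [coeff_sc_mul_apply]
  change _ * toFld _ = (if n ≤ 0 then w τ s (-n).toNat else 0) α γ
  have hz : zcoeff (kd α γ - 1 - n) (shift (-1) γ (τ (s + root α γ))) =
      zcoeff (-n) ((if α = γ then 1 else PowerSeries.X) * shift (-1) γ (τ (s + root α γ))) := by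
    by_cases h : α = γ
    · subst h
      rw [kd_self, if_pos rfl, one_mul, sub_self, zero_sub]
    · rw [kd_of_ne h, if_neg h, ← zcoeff_X_mul, show 0 - 1 - n + 1 = -n by ring]
  rw [hz]
  by_cases hn : n ≤ 0
  · rw [if_pos hn, zcoeff_of_nonneg (by omega), w, Matrix.of_apply, map_zsmul, zsmul_eq_mul,
      div_eq_inv_mul]
  · rw [if_neg hn, zcoeff_of_neg (by omega), smul_zero, map_zero, mul_zero, Matrix.zero_apply]

/-- `H(s)` is the first coefficient `w_1` of the wave function: its diagonal comes from the linear
term of `τ(s, t - [z⁻¹]_κ)`. -/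
theorem coeff_neg_one_What (s : Charge N) : (What τ s).coeff (-1) = H τ s := by
  change w τ s 1 = _
  ext l k
  rw [w, H, Matrix.of_apply, Matrix.of_apply]
  by_cases h : l = k
  · subst h
    rw [eps_self, if_pos rfl, if_pos rfl, one_mul, root_self, add_zero, coeff_one_shift, dt_toFld,
      neg_one_smul, map_neg, Int.cast_one, one_mul, neg_div]
  · rw [if_neg h, if_neg h, ← pow_one PowerSeries.X, PowerSeries.coeff_X_pow_mul', if_pos le_rfl,
      Nat.sub_self, coeff_zero_shift]

/-! ### The dressing operator -/

/-- The operator `What(s)⁻¹`. -/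
noncomputable def Vhat (τ : Charge N → Ser N) (s : Charge N) : Op N :=
  Vt τ s * sc (toFld (τ s))⁻¹

/-- The operator `W(s)⁻¹`. -/
noncomputable def Winv (τ : Charge N → Ser N) (s : Charge N) : Op N := Lam (-s.1) * Vhat τ s

theorem isDiff_sc (y : Fld N) : PDO.IsDiff (sc y) := PDO.isDiff_single le_rfl _

theorem ordLE_What (s : Charge N) : PDO.OrdLE (What τ s) 0 :=
  fun _ hn => if_neg (not_le.2 hn)

theorem ordLE_Vhat (s : Charge N) : PDO.OrdLE (Vhat τ s) 0 :=
  (ordLE_Vt s).mul (PDO.ordLE_single 0 _)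

variable {s : Charge N}

theorem coeff_zero_What (hs : τ s ≠ 0) : (What τ s).coeff 0 = 1 := by
  rw [← sc_mul_Wt, sc, PDO.coeff_single_zero_mul, coeff_zero_Wt, smul_mul_smul_comm,
    inv_mul_cancel₀ (toFld_ne_zero hs), one_mul, one_smul]

theorem coeff_zero_Vhat (hs : τ s ≠ 0) : (Vhat τ s).coeff 0 = 1 := by
  have h := (ordLE_Vt (τ := τ) s).coeff_mul_top (PDO.ordLE_single 0 ((toFld (τ s))⁻¹ • (1 : Mat N)))
  rw [add_zero] at h
  rw [Vhat, sc, h, coeff_zero_Vt, PDO.coeff_single, if_pos rfl, smul_mul_smul_comm,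
    mul_inv_cancel₀ (toFld_ne_zero hs), one_mul, one_smul]

theorem der_coeff_zero_What (hs : τ s ≠ 0) : (del N).matrix N ((What τ s).coeff 0) = 0 := by
  rw [coeff_zero_What hs, AddDer.map_one]

theorem der_coeff_zero_Vhat (hs : τ s ≠ 0) : (del N).matrix N ((Vhat τ s).coeff 0) = 0 := by
  rw [coeff_zero_Vhat hs, AddDer.map_one]

theorem monic_of_coeff_zero {a : Op N} (ha : PDO.OrdLE a 0) (h : a.coeff 0 = 1) :
    PDO.OrdLE (a - 1) (-1) :=
  (ha.sub PDO.ordLE_one).pred (by rw [PDO.coeff_sub, h, PDO.coeff_one, if_pos rfl, sub_self])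

theorem IsTau.isDiff_What_mul (hτ : IsTau τ) (s s' : Charge N) :
    PDO.IsDiff (What τ s * Lam (s.1 - s'.1) * Vhat τ s') := by
  have h := ((isDiff_sc (toFld (τ s))⁻¹).mul (hτ.isDiff_mul s s')).mul (isDiff_sc (toFld (τ s'))⁻¹)
  rwa [← mul_assoc, ← mul_assoc, sc_mul_Wt, mul_assoc _ (Vt τ s')] at h

theorem What_mul_Vhat (hτ : IsTau τ) (hs : τ s ≠ 0) : What τ s * Vhat τ s = 1 := by
  have h := hτ.isDiff_What_mul s s
  rw [sub_self, Lam_zero, mul_one] at h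
  refine sub_eq_zero.1 ((h.sub (PDO.isDiff_single le_rfl 1)).eq_zero ?_)
  have h1 : What τ s * Vhat τ s - PDO.single 0 1 =
      (What τ s - 1) * Vhat τ s + (Vhat τ s - 1) := by
    rw [sub_mul, one_mul, sub_add_sub_cancel]
    rfl
  rw [h1]
  exact ((monic_of_coeff_zero (ordLE_What s) (coeff_zero_What hs)).mul (ordLE_Vhat s)).add
    (monic_of_coeff_zero (ordLE_Vhat s) (coeff_zero_Vhat hs))

theorem Vhat_mul_What (hτ : IsTau τ) (hs : τ s ≠ 0) : Vhat τ s * What τ s = 1 :=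
  PDO.mul_eq_one_of_monic (monic_of_coeff_zero (ordLE_What s) (coeff_zero_What hs))
    (What_mul_Vhat hτ hs)

theorem W_eq (s : Charge N) : W τ s = What τ s * Lam s.1 := rfl

theorem W_mul_Winv (hτ : IsTau τ) (hs : τ s ≠ 0) : W τ s * Winv τ s = 1 := by
  rw [W_eq, Winv, mul_assoc, ← mul_assoc (Lam _), Lam_mul_Lam, add_neg_cancel, Lam_zero, one_mul,
    What_mul_Vhat hτ hs]

theorem Winv_mul_W (hτ : IsTau τ) (hs : τ s ≠ 0) : Winv τ s * W τ s = 1 := by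
  rw [W_eq, Winv, mul_assoc, ← mul_assoc (Vhat τ s), Vhat_mul_What hτ hs, one_mul, Lam_mul_Lam,
    neg_add_cancel, Lam_zero]

theorem isUnit_W (hτ : IsTau τ) (hs : τ s ≠ 0) : IsUnit (W τ s) :=
  ⟨⟨W τ s, Winv τ s, W_mul_Winv hτ hs, Winv_mul_W hτ hs⟩, rfl⟩

theorem inverse_W (hτ : IsTau τ) (hs : τ s ≠ 0) : Ring.inverse (W τ s) = Winv τ s :=
  Ring.inverse_unit ⟨W τ s, Winv τ s, W_mul_Winv hτ hs, Winv_mul_W hτ hs⟩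

theorem L_eq (hτ : IsTau τ) (hs : τ s ≠ 0) : L τ s = W τ s * delOp N * Winv τ s := by
  rw [L, inverse_W hτ hs]

theorem R_eq (hτ : IsTau τ) (hs : τ s ≠ 0) (α : Fin N) :
    R τ s α = W τ s * PDO.single 0 (E α) * Winv τ s := by
  rw [R, inverse_W hτ hs]

theorem L_eq_What (hτ : IsTau τ) (hs : τ s ≠ 0) : L τ s = What τ s * delOp N * Vhat τ s := by
  rw [L_eq hτ hs, W_eq, Winv, mul_assoc (What τ s), Lam_mul_delOp, ← mul_assoc, ← mul_assoc,
    mul_assoc _ (Lam _) (Lam _), Lam_mul_Lam, add_neg_cancel, Lam_zero, mul_one]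

theorem W_single_Winv (s : Charge N) (m : ℤ) (α : Fin N) :
    W τ s * PDO.single m (E α) * Winv τ s = What τ s * PDO.single m (E α) * Vhat τ s := by
  rw [W_eq, Winv, mul_assoc (What τ s), Lam_mul_single, ← single_mul_Lam, ← mul_assoc, ← mul_assoc,
    mul_assoc _ (Lam _) (Lam _), Lam_mul_Lam, add_neg_cancel, Lam_zero, mul_one]

theorem conj_mul_conj (hτ : IsTau τ) (hs : τ s ≠ 0) (x y : Op N) :
    W τ s * x * Winv τ s * (W τ s * y * Winv τ s) = W τ s * (x * y) * Winv τ s := by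
  simp only [mul_assoc]
  rw [← mul_assoc (Winv τ s) (W τ s), Winv_mul_W hτ hs, one_mul]

theorem L_pow_mul_R (hτ : IsTau τ) (hs : τ s ≠ 0) (j : ℕ) (κ : Fin N) :
    L τ s ^ j * R τ s κ = W τ s * PDO.single j (E κ) * Winv τ s := by
  have h : L τ s ^ j = W τ s * delOp N ^ j * Winv τ s := by
    induction j with
    | zero => rw [pow_zero, pow_zero, mul_one, W_mul_Winv hτ hs]
    | succ j ih => rw [pow_succ, ih, L_eq hτ hs, conj_mul_conj hτ hs, ← pow_succ]
  rw [h, R_eq hτ hs, conj_mul_conj hτ hs, delOp, PDO.single_one_pow,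
    PDO.single_mul_single _ (der_E _ κ), one_mul, add_zero]

/-! ### The evolution of the dressing operator -/

/-- The linear equation `∂W/∂t_{κ j} = B_{κ j} W - L^j R_κ W` for the dressing operator, multiplied
by `W⁻¹`. -/
theorem B_eq (hτ : IsTau τ) (hs : τ s ≠ 0) (κ : Fin N) (j : ℕ+) :
    B τ s κ j = opDt κ j (W τ s) * Winv τ s + W τ s * PDO.single j (E κ) * Winv τ s := by
  have hW : opDt κ j (W τ s) * Winv τ s = opDt κ j (What τ s) * Vhat τ s := by
    rw [W_eq, opDt_mul, opDt_Lam, mul_zero, zero_add, Winv, mul_assoc, ← mul_assoc (Lam _),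
      Lam_mul_Lam, add_neg_cancel, Lam_zero, one_mul]
  rw [B, L_pow_mul_R hτ hs, hW, W_single_Winv]
  refine PDO.IsDiff.diffPart_eq ?_ ?_
  · have h := hτ.isDiff_derivative_mul s s κ j
    rw [sub_self, Lam_zero, mul_one, mul_one] at h
    -- `∂(τ What)/∂t = (∂τ/∂t) What + τ ∂What/∂t`, and `(∂τ/∂t) What What⁻¹` is a function
    have hWt : Wt τ s = sc (toFld (τ s)) * What τ s := by
      rw [← sc_mul_Wt, ← mul_assoc, sc_mul_sc, mul_inv_cancel₀ (toFld_ne_zero hs), sc_one, one_mul]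
    have h1 : opDt κ j (What τ s) * Vhat τ s + What τ s * PDO.single j (E κ) * Vhat τ s =
        sc (toFld (τ s))⁻¹ * (((opDt κ j (Wt τ s) + Wt τ s * PDO.single j (E κ)) * Vt τ s) *
          sc (toFld (τ s))⁻¹ - sc (dt (κ, j) (toFld (τ s)))) := by
      have h2 : sc (toFld (τ s))⁻¹ * sc (toFld (τ s)) = (1 : Op N) := by
        rw [sc_mul_sc, inv_mul_cancel₀ (toFld_ne_zero hs), sc_one]
      have h3 : sc (dt (κ, j) (toFld (τ s))) =
          sc (dt (κ, j) (toFld (τ s))) * What τ s * Vhat τ s := by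
        rw [mul_assoc, What_mul_Vhat hτ hs, mul_one]
      rw [hWt, opDt_mul, opDt_sc, mul_assoc _ (Vt τ s), ← Vhat]
      nth_rw 2 [h3]
      rw [← sub_mul, ← mul_assoc, show ∀ a b c : Op N, a + b + c - b = a + c from
        fun a b c => by abel, mul_assoc (sc _) (What τ s), ← mul_add, ← mul_assoc (sc _) (sc _), h2,
        one_mul, add_mul]
    rw [h1]
    exact (isDiff_sc _).mul ((h.mul (isDiff_sc _)).sub (isDiff_sc _))
  · rw [sub_add_cancel_right]
    refine PDO.OrdLE.neg ?_
    have h1 : PDO.OrdLE (opDt κ j (What τ s)) 0 := fun n hn => by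
      change ((dt (κ, j)).matrix N).toHom _ = 0
      rw [ordLE_What s n hn, map_zero]
    have h2 : PDO.OrdLE (opDt κ j (What τ s)) (-1) := h1.pred (by
      change (dt (κ, j)).matrix N ((What τ s).coeff 0) = 0
      rw [coeff_zero_What hs]
      exact AddDer.map_one _)
    exact h2.mul (ordLE_Vhat s)

/-- The Lax equation for the conjugate `W X W⁻¹` of a constant operator `X` that commutes with
`∂^j E_κ`. -/
theorem opDt_conj (hτ : IsTau τ) (hs : τ s ≠ 0) (κ : Fin N) (j : ℕ+) {X : Op N}
    (hX : opDt κ j X = 0) (hc : X * PDO.single j (E κ) = PDO.single j (E κ) * X) :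
    opDt κ j (W τ s * X * Winv τ s) =
      B τ s κ j * (W τ s * X * Winv τ s) - (W τ s * X * Winv τ s) * B τ s κ j := by
  set V := Winv τ s
  have hVW : V * W τ s = 1 := Winv_mul_W hτ hs
  have hWV : W τ s * V = 1 := W_mul_Winv hτ hs
  set Y := W τ s * X * V with hY
  have hYW : Y * W τ s = W τ s * X := by rw [hY, mul_assoc, hVW, mul_one]
  have h1 : Y * opDt κ j (W τ s) + opDt κ j Y * W τ s = opDt κ j (W τ s) * X := by
    rw [← opDt_mul, hYW, opDt_mul, hX, mul_zero, zero_add]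
  have h2 : opDt κ j Y = opDt κ j (W τ s) * X * V - Y * opDt κ j (W τ s) * V := by
    rw [← h1, add_mul, add_sub_cancel_left, mul_assoc, hWV, mul_one]
  have h3 : V * Y = X * V := by rw [hY, mul_assoc, ← mul_assoc, hVW, one_mul]
  rw [h2, B_eq hτ hs, add_mul, mul_add, mul_assoc _ V Y, mul_assoc _ V Y, h3, ← mul_assoc Y,
    ← mul_assoc Y, ← mul_assoc Y, hYW, mul_assoc _ X, mul_assoc (W τ s) X, hc]
  simp only [mul_assoc]
  abel

theorem single_E_mul_delOp (m : ℤ) (κ : Fin N) :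
    delOp N * PDO.single m (E κ) = PDO.single m (E κ) * delOp N := by
  rw [delOp, PDO.single_mul_single _ (der_E _ κ), PDO.single_mul_single _ (AddDer.map_one _),
    one_mul, mul_one, add_comm]

theorem single_E_comm (m n : ℤ) (α κ : Fin N) :
    (PDO.single n (E α) * PDO.single m (E κ) : Op N) = PDO.single m (E κ) * PDO.single n (E α) := by
  rw [PDO.single_mul_single _ (der_E _ κ), PDO.single_mul_single _ (der_E _ α), E_mul_E, E_mul_E,
    add_comm]
  by_cases h : α = κ
  · rw [h]
  · rw [if_neg h, if_neg (Ne.symm h)]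

/-! ### The change of the charge -/

theorem sum_E_filter_apply (α β i j : Fin N) :
    (∑ γ with γ ≠ α ∧ γ ≠ β, E γ : Mat N) i j = if i = j ∧ j ≠ α ∧ j ≠ β then 1 else 0 := by
  rw [Matrix.sum_apply, sum_filter, sum_eq_single j]
  · rw [E_apply]
    split_ifs <;> grind
  · intro γ _ hγ
    rw [E_apply]
    split_ifs <;> grind
  · intro h
    exact absurd (mem_univ j) h

theorem isDiff_P (s : Charge N) (α β : Fin N) : PDO.IsDiff (P τ s α β) :=
  (PDO.isDiff_single zero_le_one _).add (PDO.isDiff_single le_rfl _)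

/-- `P_{α,β}(s)` is `W(s + e_α - e_β) W(s)⁻¹`: both are differential operators, and they agree up to
terms of negative order. -/
theorem P_eq (hτ : IsTau τ) (hs : τ s ≠ 0) {α β : Fin N} (hαβ : α ≠ β)
    (hs' : τ (s + root α β) ≠ 0) : P τ s α β = W τ (s + root α β) * Winv τ s := by
  have hroot : (s + root α β).1 - s.1 = (root α β).1 := add_sub_cancel_left _ _
  have hQ : W τ (s + root α β) * Winv τ s =
      What τ (s + root α β) * Lam (root α β).1 * Vhat τ s := by
    rw [W_eq, Winv, mul_assoc, ← mul_assoc (Lam _), Lam_mul_Lam, ← sub_eq_add_neg, hroot, mul_assoc]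
  have hdiff := hτ.isDiff_What_mul (s + root α β) s
  rw [hroot] at hdiff
  rw [hQ]
  refine sub_eq_zero.1 (((isDiff_P s α β).sub hdiff).eq_zero ?_)
  have hP : P τ s α β - What τ (s + root α β) * Lam (root α β).1 * Vhat τ s =
      (P τ s α β * What τ s - What τ (s + root α β) * Lam (root α β).1) * Vhat τ s := by
    rw [sub_mul, mul_assoc (P τ s α β), What_mul_Vhat hτ hs, mul_one]
  rw [hP]
  refine PDO.OrdLE.mul (m := -1) ?_ (ordLE_Vhat s)
  -- the column `j` of `What diag(∂^d)` is that of `What` with the exponents raised by `d_j`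
  have hα : (root α β).1 α = 1 := by simp [root, hαβ]
  have hβ : (root α β).1 β = -1 := by simp [root, hαβ.symm]
  have hγ : ∀ γ, γ ≠ α → γ ≠ β → (root α β).1 γ = 0 := fun γ h1 h2 => by simp [root, h1, h2]
  have hle : ∀ γ, (root α β).1 γ ≤ 1 := fun γ => by
    by_cases h1 : γ = α
    · rw [h1, hα]
    · by_cases h2 : γ = β
      · rw [h2, hβ]; omega
      · rw [hγ γ h1 h2]; omega
  have hne : ∀ γ, γ ≠ α → (root α β).1 γ ≤ 0 := fun γ h1 => by
    by_cases h2 : γ = β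
    · rw [h2, hβ]; omega
    · rw [hγ γ h1 h2]
  have hPord : PDO.OrdLE (P τ s α β) 1 :=
    (PDO.ordLE_single 1 _).add ((PDO.ordLE_single 0 _).mono zero_le_one)
  have hP1 : (P τ s α β).coeff 1 = E α := by
    rw [P, PDO.coeff_add, PDO.coeff_single, PDO.coeff_single, if_pos rfl, if_neg one_ne_zero,
      add_zero]
  have hP0 : (P τ s α β).coeff 0 = H τ (s + root α β) * E α - E α * H τ s +
      ∑ γ with γ ≠ α ∧ γ ≠ β, E γ := by
    rw [P, PDO.coeff_add, PDO.coeff_single, PDO.coeff_single, if_pos rfl, if_neg zero_ne_one,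
      zero_add]
  have hT : PDO.OrdLE (What τ (s + root α β) * Lam (root α β).1) 1 := fun n hn => by
    ext i j
    rw [coeff_mul_Lam_apply, ordLE_What _ _ (by have := hle j; omega)]
  have htop := hPord.coeff_mul_top (ordLE_What (τ := τ) s)
  have hsub := hPord.coeff_mul_subtop (ordLE_What (τ := τ) s) (der_coeff_zero_What hs)
  rw [coeff_zero_What hs, mul_one, hP1, add_zero] at htop
  rw [coeff_zero_What hs, mul_one, hP1, add_zero,
    sub_self, zero_sub, hP0, coeff_neg_one_What] at hsub
  have hord : PDO.OrdLE (P τ s α β * What τ s - What τ (s + root α β) * Lam (root α β).1) 1 :=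
    PDO.OrdLE.sub (hPord.mul (ordLE_What s)) hT
  refine PDO.OrdLE.pred (m := 0) (PDO.OrdLE.pred (m := 1) hord ?_) ?_
  · rw [PDO.coeff_sub, htop, sub_eq_zero]
    ext i j
    rw [coeff_mul_Lam_apply, E_apply]
    by_cases h : j = α
    · subst h
      rw [hα, sub_self, coeff_zero_What hs', Matrix.one_apply]
      simp [eq_comm]
    · rw [ordLE_What _ _ (by have := hne j h; omega), if_neg fun h' => h h'.2.symm,
        Matrix.zero_apply]
  · rw [PDO.coeff_sub, hsub, sub_eq_zero]
    ext i j
    rw [coeff_mul_Lam_apply, show ∀ a b c : Mat N, a + (b - a + c) = b + c from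
      fun a b c => by abel, Matrix.add_apply, mul_E_apply, sum_E_filter_apply]
    by_cases h : j = α
    · subst h
      rw [hα, zero_sub, coeff_neg_one_What]
      simp
    · rw [if_neg (Ne.symm h), zero_add]
      by_cases h2 : j = β
      · subst h2
        rw [hβ, ordLE_What _ _ (by omega), if_neg fun h' => h'.2.2 rfl, Matrix.zero_apply]
      · rw [hγ j h h2, sub_zero, coeff_zero_What hs', Matrix.one_apply]
        simp [h, h2]

/-! ### The hierarchy -/

theorem L_form (hτ : IsTau τ) (hs : τ s ≠ 0) :
    (∀ n, 1 < n → (L τ s).coeff n = 0) ∧ (L τ s).coeff 1 = 1 ∧ (L τ s).coeff 0 = 0 := by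
  have ha : PDO.OrdLE (What τ s * delOp N) 1 := (ordLE_What s).mul (PDO.ordLE_single 1 1)
  have hcoeff : ∀ n, (What τ s * delOp N).coeff n = (What τ s).coeff (n - 1) := fun n => by
    rw [delOp, PDO.coeff_mul_single _ (AddDer.map_one _), mul_one]
  have h0 : (What τ s).coeff (-1) + (Vhat τ s).coeff (-1) = 0 := by
    have h := (ordLE_What (τ := τ) s).coeff_mul_subtop (ordLE_Vhat (τ := τ) s)
      (der_coeff_zero_Vhat hs)
    rw [What_mul_Vhat hτ hs, coeff_zero_What hs, coeff_zero_Vhat hs, add_zero, one_mul,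
      mul_one, PDO.coeff_one, if_neg (by norm_num), add_comm] at h
    exact h.symm
  have h1 := ha.coeff_mul_top (ordLE_Vhat (τ := τ) s)
  have h2 := ha.coeff_mul_subtop (ordLE_Vhat (τ := τ) s)
      (der_coeff_zero_Vhat hs)
  rw [L_eq_What hτ hs]
  refine ⟨ha.mul (ordLE_Vhat s), ?_, ?_⟩
  · rw [add_zero, hcoeff, sub_self, coeff_zero_What hs, coeff_zero_Vhat hs, mul_one] at h1
    exact h1
  · rw [add_zero, hcoeff, hcoeff, sub_self, zero_sub, coeff_zero_What hs, coeff_zero_Vhat hs,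
      one_mul, mul_one, add_comm, h0] at h2
    exact h2

theorem R_form (hτ : IsTau τ) (hs : τ s ≠ 0) (α : Fin N) :
    (∀ n, 0 < n → (R τ s α).coeff n = 0) ∧ (R τ s α).coeff 0 = E α := by
  have hsingle := PDO.ordLE_single (D := (del N).matrix N) 0 (E α)
  have ha := (ordLE_What (τ := τ) s).mul hsingle
  have h1 := (ordLE_What (τ := τ) s).coeff_mul_top hsingle
  have h2 := ha.coeff_mul_top (ordLE_Vhat (τ := τ) s)
  rw [R_eq hτ hs, W_single_Winv]
  refine ⟨ha.mul (ordLE_Vhat s), ?_⟩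
  rw [h1, coeff_zero_What hs, coeff_zero_Vhat hs, one_mul, mul_one, PDO.coeff_single,
    if_pos rfl] at h2
  exact h2

end Tau
end MultiKP

theorem mainTheorem6 (N : ℕ) (τ : Charge N → Ser N) (hτ : IsTau τ) (s : Charge N) (hs : τ s ≠ 0) :
    -- the dressing operator is invertible, and `L`, `R_α` have the expected form
    IsUnit (W τ s) ∧
    ((∀ n, 1 < n → (L τ s).coeff n = 0) ∧ (L τ s).coeff 1 = 1 ∧ (L τ s).coeff 0 = 0) ∧
    (∀ α, (∀ n, 0 < n → (R τ s α).coeff n = 0) ∧ (R τ s α).coeff 0 = E α) ∧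
    -- algebraic relations
    (∀ α, L τ s * R τ s α = R τ s α * L τ s) ∧
    (∀ α β, R τ s α * R τ s β = if α = β then R τ s α else 0) ∧
    ∑ α, R τ s α = 1 ∧
    -- Lax equations
    (∀ γ j, opDt γ j (L τ s) = B τ s γ j * L τ s - L τ s * B τ s γ j) ∧
    (∀ γ j β, opDt γ j (R τ s β) = B τ s γ j * R τ s β - R τ s β * B τ s γ j) ∧
    -- change of the charge
    (∀ α β, α ≠ β → τ (s + root α β) ≠ 0 →
      W τ (s + root α β) = P τ s α β * W τ s ∧
      L τ (s + root α β) * P τ s α β = P τ s α β * L τ s ∧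
      (∀ γ, R τ (s + root α β) γ * P τ s α β = P τ s α β * R τ s γ) ∧
      (∀ γ j, opDt γ j (P τ s α β) =
        B τ (s + root α β) γ j * P τ s α β - P τ s α β * B τ s γ j)) := by
  refine ⟨isUnit_W hτ hs, L_form hτ hs, R_form hτ hs, fun α => ?_, fun α β => ?_, ?_, fun γ j => ?_,
    fun γ j β => ?_, fun α β hαβ hs' => ?_⟩
  · rw [L_eq hτ hs, R_eq hτ hs, conj_mul_conj hτ hs, conj_mul_conj hτ hs, single_E_mul_delOp]
  · rw [R_eq hτ hs, R_eq hτ hs, conj_mul_conj hτ hs, PDO.single_zero_mul_single, E_mul_E]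
    split_ifs
    · rfl
    · rw [show (PDO.single 0 0 : Op N) = 0 from PDO.ext (funext fun n => ite_self 0), mul_zero,
        zero_mul]
  · simp only [R_eq hτ hs]
    rw [← Finset.sum_mul, ← Finset.mul_sum, sum_single_E]
    exact (congrArg (· * Winv τ s) (mul_one _)).trans (W_mul_Winv hτ hs)
  · rw [L_eq hτ hs]
    exact opDt_conj hτ hs γ j (opDt_delOp γ j) (single_E_mul_delOp _ γ)
  · rw [R_eq hτ hs]
    exact opDt_conj hτ hs γ j (opDt_single_E γ j 0 β) (single_E_comm _ _ β γ)
  · have hP := P_eq hτ hs hαβ hs'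
    have hPW : P τ s α β * W τ s = W τ (s + root α β) := by
      rw [hP, mul_assoc, Winv_mul_W hτ hs, mul_one]
    have hVP : Winv τ (s + root α β) * P τ s α β = Winv τ s := by
      rw [hP, ← mul_assoc, Winv_mul_W hτ hs', one_mul]
    have hconj : ∀ x : Op N, W τ (s + root α β) * x * Winv τ (s + root α β) * P τ s α β =
        P τ s α β * (W τ s * x * Winv τ s) := fun x => by
      rw [mul_assoc, hVP, ← mul_assoc, ← mul_assoc, hPW]
    refine ⟨hPW.symm, ?_, fun γ => ?_, fun γ j => ?_⟩
    · rw [L_eq hτ hs, L_eq hτ hs', hconj]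
    · rw [R_eq hτ hs, R_eq hτ hs', hconj]
    · have h1 : P τ s α β * opDt γ j (W τ s) + opDt γ j (P τ s α β) * W τ s =
          opDt γ j (W τ (s + root α β)) := by rw [← opDt_mul, hPW]
      have h2 : opDt γ j (P τ s α β) = opDt γ j (W τ (s + root α β)) * Winv τ s -
          P τ s α β * (opDt γ j (W τ s) * Winv τ s) := by
        rw [← h1, add_mul, mul_assoc, add_sub_cancel_left, mul_assoc, W_mul_Winv hτ hs, mul_one]
      rw [h2, B_eq hτ hs, B_eq hτ hs', add_mul, hconj, mul_add, mul_assoc _ _ (P τ s α β), hVP,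
        add_sub_add_right_eq_sub]
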